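/- **Notation.** For a complex binary form $F(x,y)=\prod_{k=1}^n(\beta_kx-\alpha_ky)$ of degree $n$, let $\|F\|$ be the sum of the squared absolute values of its coefficients, and call $F$ *stable* if no linear factor of $F$ has multiplicity $\ge n/2$ (so $F\ne0$ and $n\ge3$). The group $\mathrm{SL}(2,\mathbb C)$ acts on forms by $F\cdot\begin{pmatrix}a&b\\c&d\end{pmatrix}=F(ax+by,cx+dy)$, and in the standard way from the left on hyperbolic space $\mathcal H_3=\{t+uj: t\in\mathbb C,\ u>0\}$ with hyperbolic distance $\mathrm{dist}$; the upper half-plane is $\mathcal H=\{t+uj\in\mathcal H_3: t\in\mathbb R\}$. Put $$R(F,t+uj)=\prod_{k=1}^n\frac{|\alpha_k-\beta_kt|^2+|\beta_k|^2u^2}{u}.$$ For stable $F$, let $z(F)\in\mathcal H_3$ be the unique minimizer of $R(F,\cdot)$ and $\theta(F)=R(F,z(F))$. Choose $F_0$ in the $\mathrm{SL}(2,\mathbb C)$-orbit of $F$ (in the $\mathrm{SL}(2,\mathbb R)$-orbit if $F$ is real) with $z(F_0)=j$, and let $\varepsilon_F:[0,\infty)\to[1,\infty)$ be the increasing bijection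 $$\varepsilon_F(\delta)=\min_{w:\ \mathrm{dist}(w,j)=\delta}\frac{R(F_0,w)}{R(F_0,j)},$$ where $w$ runs through $\mathcal H_3$; when $F$ is real one may also let $w$ run only through $\mathcal H$, and the result below holds for both versions of $\varepsilon_F$. Let $d\ge2$. A degree-$d$ endomorphism $f=[F:G]$ of $\mathbb P^1$ is given by two binary forms $F,G\in\mathbb Z[x,y]$ of degree $d$ without common zero in $\mathbb P^1(\mathbb C)$ and whose coefficients, taken together, have greatest common divisor $1$; $H(f)$ is the multiplicative height of the vector of all coefficients of $F$ and $G$. For $\gamma=\begin{pmatrix}a&b\\c&d'\end{pmatrix}\in\mathrm{SL}(2,\mathbb Z)$ let $$f^\gamma=[\,d'\,(F\cdot\gamma)-b\,(G\cdot\gamma):-c\,(F\cdot\gamma)+a\,(G\cdot\gamma)\,].$$ With $f^m=[F_m:G_m]$ the $m$-th iterate, put $\Phi_m(f)=yF_m-xG_m$ and $\Phi_m^*(f)=\prod_{k\mid m}\Phi_k(f)^{\mu(m/k)}$. **Statement.** Let $d\ge2$ and $m\ge1$, and let $\Phi(f)$ stand for $\Phi_m(f)$ (for all $f$) or for $\Phi^*_m(f)$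 (for all $f$). (i) There are real constants $C,k>0$ such that $\|\Phi(f)\|\le C\,H(f)^k$ for all degree-$d$ endomorphisms $f$ as above. (ii) Let $C,k>0$ be any real constants as in (i). Let $f$ be a degree-$d$ endomorphism as above such that $\Phi=\Phi(f)$ is stable, and put $$c=\cosh\varepsilon_\Phi^{-1}\!\left(2^{\deg\Phi-1}\,\frac{C\,H(f)^k}{\theta(\Phi)}\right).$$ If $\gamma\in\mathrm{SL}(2,\mathbb Z)$ and $\gamma^{-1}\cdot z(\Phi)=t+uj$ satisfies $\dfrac{|t|^2+u^2+1}{2u}>c$, then $H(f^\gamma)>H(f)$. (iii) In the situation of (ii), the set $\Gamma$ of all $\gamma\in\mathrm{SL}(2,\mathbb Z)$ for which $\gamma^{-1}\cdot z(\Phi)=t+uj$ satisfies $\dfrac{|t|^2+u^2+1}{2u}\le c$ is finite, and it contains an element $\gamma_0$ with $H(f^{\gamma_0})\le H(f^\gamma)$ for all $\gamma\in\mathrm{SL}(2,\mathbb Z)$. -/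

import Mathlib

open scoped MatrixGroups

namespace EndoBound

open MvPolynomial

noncomputable section

/-! ### Binary forms -/

/-- Binary forms are homogeneous polynomials in `x = X 0` and `y = X 1`. -/
abbrev FormPoly (R : Type*) [CommRing R] := MvPolynomial (Fin 2) R

/-- The right action `F · γ = F (a x + b y, c x + d y)` for `γ = (a b; c d)`. -/
def subst {R : Type*} [CommRing R] (F : FormPoly R) (γ : SL(2, R)) : FormPoly R :=
  bind₁ (fun i => C (γ i 0) * X 0 + C (γ i 1) * X 1) F

/-- The size of `F`: the sum of the squared absolute values of the coefficients. -/
def size (F : FormPoly ℂ) : ℝ := ∑ e ∈ F.support, ‖F.coeff e‖ ^ 2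

/-- `F` is a binary form of degree `n = deg F`, and no linear factor of `F` has
multiplicity at least `n / 2`. -/
def IsStable (F : FormPoly ℂ) : Prop :=
  F.IsHomogeneous F.totalDegree ∧
    ∀ a b : ℂ, (a, b) ≠ (0, 0) → ∀ k : ℕ, F.totalDegree ≤ 2 * k →
      ¬ (C a * X 0 + C b * X 1) ^ k ∣ F

/-! ### Hyperbolic three-space -/

/-- The upper half-space model: `⟨t, u, _⟩` is the point `t + u j`. -/
@[ext] structure HSpace where
  t : ℂ
  u : ℝ
  u_pos : 0 < u

/-- The point `j`. -/
def jPt : HSpace := ⟨0, 1, one_pos⟩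

/-- Hyperbolic distance:
`cosh (dist z w) = 1 + (|z.t - w.t| ^ 2 + (z.u - w.u) ^ 2) / (2 * z.u * w.u)`. -/
def hdist (z w : HSpace) : ℝ :=
  Real.arcosh (1 + (‖z.t - w.t‖ ^ 2 + (z.u - w.u) ^ 2) / (2 * z.u * w.u))

theorem denom_pos (γ : SL(2, ℂ)) (z : HSpace) :
    0 < ‖γ 1 0 * z.t + γ 1 1‖ ^ 2 + ‖γ 1 0‖ ^ 2 * z.u ^ 2 := by
  have hu := z.u_pos
  by_cases hc : γ 1 0 = 0
  · have hd : γ 1 1 ≠ 0 := by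
      intro hd
      have h := γ.det_coe
      rw [Matrix.det_fin_two] at h
      simp [hc, hd] at h
    have : 0 < ‖γ 1 1‖ := norm_pos_iff.mpr hd
    simp only [hc, zero_mul, zero_add, norm_zero]
    positivity
  · have : 0 < ‖γ 1 0‖ := norm_pos_iff.mpr hc
    positivity

/-- The standard left action of `SL(2, ℂ)` on hyperbolic three-space. -/
def moeb (γ : SL(2, ℂ)) (z : HSpace) : HSpace where
  t := ((γ 0 0 * z.t + γ 0 1) * star (γ 1 0 * z.t + γ 1 1) + γ 0 0 * star (γ 1 0) * (z.u : ℂ) ^ 2) /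
    ((‖γ 1 0 * z.t + γ 1 1‖ ^ 2 + ‖γ 1 0‖ ^ 2 * z.u ^ 2 : ℝ) : ℂ)
  u := z.u / (‖γ 1 0 * z.t + γ 1 1‖ ^ 2 + ‖γ 1 0‖ ^ 2 * z.u ^ 2)
  u_pos := div_pos z.u_pos (denom_pos γ z)

/-- The inclusion of `SL(2, ℤ)` in `SL(2, ℂ)`. -/
def intSL (γ : SL(2, ℤ)) : SL(2, ℂ) := Matrix.SpecialLinearGroup.map (Int.castRingHom ℂ) γ

/-- The upper half-plane inside hyperbolic three-space. -/
def realPlane : Set HSpace := {z | z.t.im = 0}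

/-! ### The covariant point, the Julia invariant and the function `ε_F` -/

open Classical in
/-- `R(F, t + u j) = ∏ (|α_k - β_k t| ^ 2 + |β_k| ^ 2 u ^ 2) / u`, where
`F = ∏ (β_k x - α_k y)` is a factorization into `deg F` linear factors. The value does not
depend on the factorization; one exists for each nonzero form, and `0` is a default. -/
def bigR (F : FormPoly ℂ) (z : HSpace) : ℝ :=
  if h : ∃ p : (Fin F.totalDegree → ℂ) × (Fin F.totalDegree → ℂ),
      F = ∏ k, (C (p.2 k) * X 0 - C (p.1 k) * X 1) then
    ∏ k, (‖h.choose.1 k - h.choose.2 k * z.t‖ ^ 2 + ‖h.choose.2 k‖ ^ 2 * z.u ^ 2) / z.u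
  else 0

open Classical in
/-- The covariant point `z(F)`: the minimizer of `R(F, ·)` on hyperbolic three-space, which
exists and is unique for stable `F`. The default is `j`. -/
def zPt (F : FormPoly ℂ) : HSpace :=
  if h : ∃ z, ∀ w, bigR F z ≤ bigR F w then h.choose else jPt

/-- The Julia invariant `θ(F) = R(F, z(F))`. -/
def theta (F : FormPoly ℂ) : ℝ := bigR F (zPt F)

/-- The matrix `(√u  t/√u; 0  1/√u)`, which maps `j` to `z = t + u j`. -/
def toPt (z : HSpace) : SL(2, ℂ) :=
  ⟨!![(Real.sqrt z.u : ℂ), z.t / Real.sqrt z.u; 0, 1 / Real.sqrt z.u], by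
    have h : (Real.sqrt z.u : ℂ) ≠ 0 := by
      exact_mod_cast (Real.sqrt_pos.mpr z.u_pos).ne'
    rw [Matrix.det_fin_two_of]
    field_simp
    ring⟩

/-- For `F₀` with `z(F₀) = j`: the minimum of `R(F₀, w) / R(F₀, j)` over the points `w` of `P` at
distance `δ` from `j`. The set `P` is all of hyperbolic three-space when one works over `ℂ`; when
one works over `ℝ` it can also be taken to be the upper half-plane. -/
def epsNormalized (P : Set HSpace) (F₀ : FormPoly ℂ) (δ : ℝ) : ℝ :=
  sInf ((fun w => bigR F₀ w / bigR F₀ jPt) '' {w | w ∈ P ∧ hdist w jPt = δ})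

/-- `ε_F = ε_{F₀}` for the form `F₀ = F · γ` with `γ · j = z(F)`, so that `z(F₀) = j`. If `z(F)`
lies in the upper half-plane, then this `γ` is real. -/
def eps (P : Set HSpace) (F : FormPoly ℂ) (δ : ℝ) : ℝ :=
  epsNormalized P (subst F (toPt (zPt F))) δ

/-- The inverse of `ε_F : [0, ∞) → [1, ∞)`. -/
def epsInv (P : Set HSpace) (F : FormPoly ℂ) : ℝ → ℝ := Function.invFunOn (eps P F) (Set.Ici 0)

/-! ### Endomorphisms of the projective line over `ℚ` -/

/-- The vector of the coefficients of `x ^ (d - i) * y ^ i` in `F = f 0` and in `G = f 1`. -/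
def coeffVec (d : ℕ) (f : Fin 2 → FormPoly ℤ) (i : Fin 2 × Fin (d + 1)) : ℤ :=
  (f i.1).coeff (Finsupp.single 0 (d - (i.2 : ℕ)) + Finsupp.single 1 (i.2 : ℕ))

/-- `f = [F : G]` with `F = f 0` and `G = f 1` is an endomorphism of `ℙ¹` of degree `d`, given by
integral forms of degree `d` with coprime coefficients. -/
structure IsModel (d : ℕ) (f : Fin 2 → FormPoly ℤ) : Prop where
  homogeneous : ∀ i, (f i).IsHomogeneous d
  coprime_coeffs : Finset.univ.gcd (coeffVec d f) = 1
  no_common_zero : ∀ v : Fin 2 → ℂ, (∀ i, aeval v (f i) = 0) → v = 0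

/-- `H(f)`: the multiplicative height of the concatenated coefficient vectors. -/
def height (d : ℕ) (f : Fin 2 → FormPoly ℤ) : ℝ :=
  Height.mulHeight (fun i => (coeffVec d f i : ℚ))

/-- The conjugate `f ^ γ = γ⁻¹ ∘ f ∘ γ`. -/
def conj (f : Fin 2 → FormPoly ℤ) (γ : SL(2, ℤ)) : Fin 2 → FormPoly ℤ :=
  ![C (γ 1 1) * subst (f 0) γ - C (γ 0 1) * subst (f 1) γ,
    -C (γ 1 0) * subst (f 0) γ + C (γ 0 0) * subst (f 1) γ]

/-- The iterates `f ^ m = [F_m : G_m]`. -/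
def iter (f : Fin 2 → FormPoly ℤ) : ℕ → Fin 2 → FormPoly ℤ
  | 0 => X
  | m + 1 => fun i => bind₁ (iter f m) (f i)

/-- `Φ_m(f) = y F_m - x G_m`. -/
def periodForm (m : ℕ) (f : Fin 2 → FormPoly ℤ) : FormPoly ℤ := X 1 * iter f m 0 - X 0 * iter f m 1

open Classical in
/-- The dynatomic form `Φ*_m(f) = ∏_{k ∣ m} Φ_k(f) ^ μ(m / k)`: the polynomial which equals this
product in the field of fractions of `ℤ[x, y]`. -/
def dynatomicForm (m : ℕ) (f : Fin 2 → FormPoly ℤ) : FormPoly ℤ :=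
  if h : ∃ Φ : FormPoly ℤ, algebraMap (FormPoly ℤ) (FractionRing (FormPoly ℤ)) Φ =
      ∏ k ∈ m.divisors, algebraMap (FormPoly ℤ) (FractionRing (FormPoly ℤ)) (periodForm k f) ^
        ArithmeticFunction.moebius (m / k) then
    h.choose
  else 0

/-- An integral form, regarded as a complex form. -/
def toC (F : FormPoly ℤ) : FormPoly ℂ := map (Int.castRingHom ℂ) F

/-- `C` and `k` are positive constants with `‖Φ(f)‖ ≤ C * H(f) ^ k` for all endomorphisms `f` of
degree `d`. -/
def IsSizeBound (d : ℕ) (Φ : (Fin 2 → FormPoly ℤ) → FormPoly ℤ) (C k : ℝ) : Prop :=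
  0 < C ∧ 0 < k ∧ ∀ f, IsModel d f → size (toC (Φ f)) ≤ C * height d f ^ k

/-- The quantity `(|t| ^ 2 + u ^ 2 + 1) / (2 u)` for the point `t + u j`. -/
def coshToJ (z : HSpace) : ℝ := (‖z.t‖ ^ 2 + z.u ^ 2 + 1) / (2 * z.u)

/-- `cosh ε_F⁻¹ (2 ^ (deg F - 1) * s / θ(F))`. -/
def searchBound (P : Set HSpace) (F : FormPoly ℂ) (s : ℝ) : ℝ :=
  Real.cosh (epsInv P F (2 ^ (F.totalDegree - 1) * (s / theta F)))

end

end EndoBound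

open EndoBound

/-! The form `Φ(f)` is covariant: `Φ(f^γ) = Φ(f) · γ`. So a bound for the size of `Φ(f^γ)` from
below is a bound for `H(f^γ)` from below, by (i).

For (ii), let `n = deg Φ` and `z = z(Φ)`. Three facts are combined. First, `R(F, j) ≤ 2 ^ (n - 1)
‖F‖` (`bigR_jPt_le_size`): reflecting linear factors in the unit circle changes neither side, and
once all reflections point the same way the two extreme coefficients suffice. Second, `R(F · M, w) =
R(F, M w)` (`wt_vact`), while `γ j` is as far from `z` as `γ⁻¹ z` is from `j`. Third, `R(Φ, w) /
θ(Φ)` exceeds `ε_Φ(δ)` once `w` is farther than `δ` from `z` (`StableFam.epsFam_lt`). If `γ⁻¹ z`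
lies beyond the bound, then `2 ^ (n - 1) C H(f) ^ k < R(Φ · γ, j) ≤ 2 ^ (n - 1) ‖Φ(f^γ)‖ ≤ 2 ^ (n -
1) C H(f^γ) ^ k`.

The properties of `z` and `ε` rest on the behaviour of `R`. Stability makes `R` coercive
(`StableFam.coercive`), so minima exist. On a geodesic ray from `j` each factor is `a exp s + b exp
(-s)` with `a, b ≥ 0` (`wt_rayPt`), so `R` is convex there, and stability makes the minimum strict.
Of `ε` only this is needed: it takes every value `≥ 1` and stays below `R / θ` at all farther
points.

For (i), the ℓ¹ norm is submultiplicative, which settles `Φ_m`. The dynatomic form divides a product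
of period forms over `ℤ`, and Mahler measure bounds the coefficients of such a factor
(`size_toC_le_of_mul_eq`).

For (iii), a bounded distance bounds the integer entries of `γ`. The identity lies in `Γ` by (ii),
and outside `Γ` the height exceeds `H(f)`. -/

namespace EndoBound

open MvPolynomial

noncomputable section

/-! ### The action of SL(2) on binary forms. -/

section Substitution

variable {R : Type*} [CommRing R]

/-- The action of `γ` on forms, as an algebra homomorphism. -/
def substHom (γ : SL(2, R)) : FormPoly R →ₐ[R] FormPoly R :=
  bind₁ (fun i => C (γ i 0) * X 0 + C (γ i 1) * X 1)

theorem subst_eq_substHom (F : FormPoly R) (γ : SL(2, R)) : subst F γ = substHom γ F := rfl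

@[simp] theorem substHom_X (γ : SL(2, R)) (i : Fin 2) :
    substHom γ (X i) = C (γ i 0) * X 0 + C (γ i 1) * X 1 := by
  simp [substHom]

@[simp] theorem substHom_C (γ : SL(2, R)) (r : R) : substHom γ (C r) = C r := by
  simp [substHom]

theorem substHom_substHom (γ δ : SL(2, R)) (F : FormPoly R) :
    substHom δ (substHom γ F) = substHom (γ * δ) F := by
  have : (substHom δ).comp (substHom γ) = substHom (γ * δ) := by
    apply MvPolynomial.algHom_ext
    intro i
    simp [Matrix.SpecialLinearGroup.coe_mul, Matrix.mul_apply, Fin.sum_univ_two]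
    ring
  exact DFunLike.congr_fun this F

theorem substHom_one (F : FormPoly R) : substHom (1 : SL(2, R)) F = F := by
  have : substHom (1 : SL(2, R)) = AlgHom.id R _ := by
    apply MvPolynomial.algHom_ext
    intro i
    fin_cases i <;> simp
  rw [this]; rfl

theorem substHom_injective (γ : SL(2, R)) : Function.Injective (substHom γ) := by
  intro F G h
  have := congrArg (substHom γ⁻¹) h
  simpa [substHom_substHom, substHom_one] using this

/-- The action of `γ` on forms, as a ring automorphism. -/
def substEquiv (γ : SL(2, R)) : FormPoly R ≃+* FormPoly R :=
  { (substHom γ).toRingHom with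
    invFun := substHom γ⁻¹
    left_inv := fun F => by
      change substHom γ⁻¹ (substHom γ F) = F
      rw [substHom_substHom, mul_inv_cancel, substHom_one]
    right_inv := fun F => by
      change substHom γ (substHom γ⁻¹ F) = F
      rw [substHom_substHom, inv_mul_cancel, substHom_one] }

theorem isHomogeneous_substHom {F : FormPoly R} {n : ℕ} (hF : F.IsHomogeneous n) (γ : SL(2, R)) :
    (substHom γ F).IsHomogeneous n := by
  have := hF.aeval (fun i => C (γ i 0) * X 0 + C (γ i 1) * X 1 : Fin 2 → FormPoly R) (n := 1)
    (fun i => (isHomogeneous_C_mul_X _ _).add (isHomogeneous_C_mul_X _ _))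
  rwa [one_mul] at this

theorem aeval_substHom (v : Fin 2 → ℂ) (γ : SL(2, ℤ)) (F : FormPoly ℤ) :
    aeval v (substHom γ F) = aeval (fun i => (γ i 0 : ℂ) * v 0 + (γ i 1 : ℂ) * v 1) F := by
  have : (aeval v).comp (substHom γ) =
      aeval (R := ℤ) (fun i => (γ i 0 : ℂ) * v 0 + (γ i 1 : ℂ) * v 1) := by
    apply MvPolynomial.algHom_ext
    intro i
    simp
  exact DFunLike.congr_fun this F

theorem toC_substHom (F : FormPoly ℤ) (γ : SL(2, ℤ)) :
    toC (substHom γ F) = substHom (intSL γ) (toC F) := by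
  simp only [toC, substHom, map_bind₁, intSL]
  congr 2
  funext i
  simp

end Substitution

/-! ### Covariance of period forms and dynatomic forms under conjugation. -/

section Conjugation

theorem det_int (γ : SL(2, ℤ)) : γ 0 0 * γ 1 1 - γ 0 1 * γ 1 0 = 1 := by
  have := γ.det_coe
  rwa [Matrix.det_fin_two] at this

theorem C_det_int (γ : SL(2, ℤ)) :
    (C (γ 0 0) * C (γ 1 1) - C (γ 0 1) * C (γ 1 0) : FormPoly ℤ) = 1 := by
  rw [← C_mul, ← C_mul, ← C_sub, det_int, C_1]

theorem conj_zero (f : Fin 2 → FormPoly ℤ) (γ : SL(2, ℤ)) :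
    conj f γ 0 = C (γ 1 1) * substHom γ (f 0) - C (γ 0 1) * substHom γ (f 1) := rfl

theorem conj_one_apply (f : Fin 2 → FormPoly ℤ) (γ : SL(2, ℤ)) :
    conj f γ 1 = -C (γ 1 0) * substHom γ (f 0) + C (γ 0 0) * substHom γ (f 1) := rfl

theorem conj_X (γ : SL(2, ℤ)) : conj X γ = X := by
  have h := C_det_int γ
  funext i
  fin_cases i
  · change conj X γ 0 = X 0
    rw [conj_zero]
    simp only [substHom_X]
    linear_combination X 0 * h
  · change conj X γ 1 = X 1
    rw [conj_one_apply]
    simp only [substHom_X]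
    linear_combination X 1 * h

theorem conj_unit (f : Fin 2 → FormPoly ℤ) : conj f 1 = f := by
  funext i
  fin_cases i
  · change conj f 1 0 = f 0
    simp [conj_zero, substHom_one]
  · change conj f 1 1 = f 1
    simp [conj_one_apply, substHom_one]

theorem conj_conj_inv (f : Fin 2 → FormPoly ℤ) (γ : SL(2, ℤ)) : conj (conj f γ) γ⁻¹ = f := by
  have h := C_det_int γ
  have e00 : γ⁻¹ 0 0 = γ 1 1 := by simp [Matrix.SpecialLinearGroup.SL2_inv_expl]
  have e01 : γ⁻¹ 0 1 = -γ 0 1 := by simp [Matrix.SpecialLinearGroup.SL2_inv_expl]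
  have e10 : γ⁻¹ 1 0 = -γ 1 0 := by simp [Matrix.SpecialLinearGroup.SL2_inv_expl]
  have e11 : γ⁻¹ 1 1 = γ 0 0 := by simp [Matrix.SpecialLinearGroup.SL2_inv_expl]
  funext i
  fin_cases i
  · change conj _ _ 0 = f 0
    simp only [conj_zero, conj_one_apply, e01, e11, map_sub, map_add, map_mul, map_neg,
      substHom_C, substHom_substHom, mul_inv_cancel, substHom_one]
    linear_combination f 0 * h
  · change conj _ _ 1 = f 1
    simp only [conj_zero, conj_one_apply, e00, e10, map_sub, map_add, map_mul, map_neg,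
      substHom_C, substHom_substHom, mul_inv_cancel, substHom_one]
    linear_combination f 1 * h

/-- This is `γ ∘ g^γ = g ∘ γ`, checked on the variables, where it reduces to `det γ = 1`. It drives
the induction over iterates. -/
theorem bind₁_conj_substHom (g : Fin 2 → FormPoly ℤ) (γ : SL(2, ℤ)) (F : FormPoly ℤ) :
    bind₁ (conj g γ) (substHom γ F) = substHom γ (bind₁ g F) := by
  have h := C_det_int γ
  have : (bind₁ (conj g γ)).comp (substHom γ) = (substHom γ).comp (bind₁ g) := by
    apply MvPolynomial.algHom_ext
    intro i
    simp only [AlgHom.comp_apply, substHom_X, map_add, map_mul, bind₁_C_right, bind₁_X_right,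
      conj_zero, conj_one_apply]
    fin_cases i
    · simp only [Fin.zero_eta]
      linear_combination substHom γ (g 0) * h
    · simp only [Fin.mk_one]
      linear_combination substHom γ (g 1) * h
  exact DFunLike.congr_fun this F

theorem iter_conj (f : Fin 2 → FormPoly ℤ) (γ : SL(2, ℤ)) (m : ℕ) :
    iter (conj f γ) m = conj (iter f m) γ := by
  induction m with
  | zero => exact (conj_X γ).symm
  | succ m ih =>
    funext i
    change bind₁ (iter (conj f γ) m) (conj f γ i) = _
    rw [ih]
    fin_cases i
    · change bind₁ _ (conj f γ 0) = conj (iter f (m + 1)) γ 0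
      simp only [conj_zero, map_sub, map_mul, bind₁_C_right, bind₁_conj_substHom]
      rfl
    · change bind₁ _ (conj f γ 1) = conj (iter f (m + 1)) γ 1
      simp only [conj_one_apply, map_add, map_mul, map_neg, bind₁_C_right, bind₁_conj_substHom]
      rfl

/-- Collecting the terms with `F_m` and with `G_m` moves the entries of `γ⁻¹` onto the coordinates,
where they form `x · γ` and `y · γ`. -/
theorem periodForm_conj (m : ℕ) (f : Fin 2 → FormPoly ℤ) (γ : SL(2, ℤ)) :
    periodForm m (conj f γ) = substHom γ (periodForm m f) := by
  simp only [periodForm, iter_conj, conj_zero, conj_one_apply, map_sub, map_mul, substHom_X]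
  ring

/-- The relation which characterizes the dynatomic form. -/
def IsDynatomic (m : ℕ) (f : Fin 2 → FormPoly ℤ) (Φ : FormPoly ℤ) : Prop :=
  algebraMap (FormPoly ℤ) (FractionRing (FormPoly ℤ)) Φ =
    ∏ k ∈ m.divisors, algebraMap (FormPoly ℤ) (FractionRing (FormPoly ℤ)) (periodForm k f) ^
      ArithmeticFunction.moebius (m / k)

theorem IsDynatomic.eq {m : ℕ} {f : Fin 2 → FormPoly ℤ} {Φ Ψ : FormPoly ℤ}
    (h : IsDynatomic m f Φ) (h' : IsDynatomic m f Ψ) : Φ = Ψ :=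
  IsFractionRing.injective (FormPoly ℤ) (FractionRing (FormPoly ℤ))
    (Eq.trans h (Eq.symm h'))

theorem IsDynatomic.dynatomicForm_eq {m : ℕ} {f : Fin 2 → FormPoly ℤ} {Φ : FormPoly ℤ}
    (h : IsDynatomic m f Φ) : dynatomicForm m f = Φ := by
  have h' : ∃ Φ, IsDynatomic m f Φ := ⟨Φ, h⟩
  have : dynatomicForm m f = h'.choose := dif_pos h'
  rw [this]
  exact h'.choose_spec.eq h

/-- A nonzero value cannot be the default `0`. Stability will supply the hypothesis. -/
theorem isDynatomic_of_ne_zero {m : ℕ} {f : Fin 2 → FormPoly ℤ} (h : dynatomicForm m f ≠ 0) :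
    IsDynatomic m f (dynatomicForm m f) := by
  by_cases h' : ∃ Φ, IsDynatomic m f Φ
  · obtain ⟨Φ, hΦ⟩ := h'
    rwa [hΦ.dynatomicForm_eq]
  · exact absurd (dif_neg h') h

theorem IsDynatomic.conj {m : ℕ} {f : Fin 2 → FormPoly ℤ} {Φ : FormPoly ℤ}
    (h : IsDynatomic m f Φ) (γ : SL(2, ℤ)) : IsDynatomic m (conj f γ) (substHom γ Φ) := by
  -- An automorphism of `ℤ[x, y]` extends to the fraction field, so it can be applied to the product
  -- with its negative exponents.
  let ψ : FractionRing (FormPoly ℤ) ≃+* FractionRing (FormPoly ℤ) :=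
    IsFractionRing.ringEquivOfRingEquiv (substEquiv γ)
  have hψ : ∀ F : FormPoly ℤ, ψ (algebraMap _ _ F) = algebraMap _ _ (substHom γ F) := fun F =>
    IsFractionRing.ringEquivOfRingEquiv_algebraMap (substEquiv γ) F
  have h2 := congrArg ψ h
  simp only [map_prod, map_zpow₀, hψ] at h2
  simpa only [IsDynatomic, periodForm_conj] using h2

theorem dynatomicForm_conj {m : ℕ} {f : Fin 2 → FormPoly ℤ} (h : dynatomicForm m f ≠ 0)
    (γ : SL(2, ℤ)) : dynatomicForm m (conj f γ) = substHom γ (dynatomicForm m f) :=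
  ((isDynatomic_of_ne_zero h).conj γ).dynatomicForm_eq

end Conjugation

/-! ### Conjugates of integral models are integral models. -/

section Models

theorem IsModel.iter_isHomogeneous {d : ℕ} {f : Fin 2 → FormPoly ℤ} (hf : IsModel d f) (m : ℕ)
    (i : Fin 2) : (iter f m i).IsHomogeneous (d ^ m) := by
  induction m generalizing i with
  | zero => exact isHomogeneous_X ℤ i
  | succ m ih => exact pow_succ d m ▸ (hf.homogeneous i).aeval (iter f m) ih

theorem isHomogeneous_conj {d : ℕ} {f : Fin 2 → FormPoly ℤ} (hf : ∀ i, (f i).IsHomogeneous d)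
    (γ : SL(2, ℤ)) (i : Fin 2) : (conj f γ i).IsHomogeneous d := by
  have h : ∀ i, (substHom γ (f i)).IsHomogeneous d := fun i => isHomogeneous_substHom (hf i) γ
  fin_cases i
  · exact ((h 0).C_mul _).sub ((h 1).C_mul _)
  · change (-C (γ 1 0) * substHom γ (f 0) + C (γ 0 0) * substHom γ (f 1)).IsHomogeneous d
    rw [← C_neg]
    exact ((h 0).C_mul _).add ((h 1).C_mul _)

theorem C_dvd_conj {n : ℤ} {f : Fin 2 → FormPoly ℤ} (h : ∀ i, C n ∣ f i) (γ : SL(2, ℤ))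
    (i : Fin 2) : C n ∣ conj f γ i := by
  have h' : ∀ i, C n ∣ substHom γ (f i) := fun i => by
    simpa using map_dvd (substHom γ) (h i)
  fin_cases i
  · exact dvd_sub ((h' 0).mul_left _) ((h' 1).mul_left _)
  · exact dvd_add ((h' 0).mul_left _) ((h' 1).mul_left _)

theorem C_dvd_iff_dvd_coeffVec {d : ℕ} {f : Fin 2 → FormPoly ℤ}
    (hf : ∀ i, (f i).IsHomogeneous d) (n : ℤ) :
    (∀ i, C n ∣ f i) ↔ ∀ i, n ∣ coeffVec d f i := by
  simp only [C_dvd_iff_dvd_coeff]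
  constructor
  · intro h i
    exact h _ _
  · intro h i e
    by_cases he : e.degree = d
    · have he' : e 0 + e 1 = d := by
        rw [← he, Finsupp.degree_eq_sum, Fin.sum_univ_two]
      have := h (i, ⟨e 1, by omega⟩)
      rw [coeffVec] at this
      have hee : e = Finsupp.single 0 (d - e 1) + Finsupp.single 1 (e 1) := by
        ext j
        fin_cases j
        · simp
          omega
        · simp
      rw [hee]
      exact this
    · rw [(hf i).coeff_eq_zero he]
      exact dvd_zero _

theorem IsModel.conj {d : ℕ} {f : Fin 2 → FormPoly ℤ} (hf : IsModel d f) (γ : SL(2, ℤ)) :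
    IsModel d (conj f γ) where
  homogeneous := isHomogeneous_conj hf.homogeneous γ
  coprime_coeffs := by
    set g := Finset.univ.gcd (coeffVec d (EndoBound.conj f γ)) with hg
    have h1 : ∀ i, g ∣ coeffVec d (EndoBound.conj f γ) i := fun i =>
      Finset.gcd_dvd (Finset.mem_univ i)
    rw [← C_dvd_iff_dvd_coeffVec (isHomogeneous_conj hf.homogeneous γ)] at h1
    -- A common divisor of the coefficients survives conjugation back to `f`, whose coefficients are
    -- coprime.
    have h2 := C_dvd_conj h1 γ⁻¹
    rw [conj_conj_inv, C_dvd_iff_dvd_coeffVec hf.homogeneous] at h2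
    have h3 : g ∣ 1 := by
      rw [← hf.coprime_coeffs]
      exact Finset.dvd_gcd fun i _ => h2 i
    rw [hg, ← Finset.normalize_gcd, ← hg]
    exact normalize_eq_one.mpr (isUnit_of_dvd_one h3)
  no_common_zero := by
    intro v hv
    have hd : (γ 0 0 : ℂ) * γ 1 1 - γ 0 1 * γ 1 0 = 1 := by exact_mod_cast det_int γ
    have h0 := hv 0
    have h1 := hv 1
    rw [conj_zero] at h0
    rw [conj_one_apply] at h1
    simp only [map_sub, map_add, map_mul, map_neg, aeval_C, aeval_substHom, algebraMap_int_eq,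
      Int.coe_castRingHom] at h0 h1
    have hw := hf.no_common_zero (fun i => (γ i 0 : ℂ) * v 0 + (γ i 1 : ℂ) * v 1) (by
      intro i
      fin_cases i
      · simp only [Fin.zero_eta]
        linear_combination (γ 0 0 : ℂ) * h0 + (γ 0 1 : ℂ) * h1 -
          (aeval (fun i => (γ i 0 : ℂ) * v 0 + (γ i 1 : ℂ) * v 1)) (f 0) * hd
      · simp only [Fin.mk_one]
        linear_combination (γ 1 0 : ℂ) * h0 + (γ 1 1 : ℂ) * h1 -
          (aeval (fun i => (γ i 0 : ℂ) * v 0 + (γ i 1 : ℂ) * v 1)) (f 1) * hd)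
    have w0 : (γ 0 0 : ℂ) * v 0 + (γ 0 1 : ℂ) * v 1 = 0 := congrFun hw 0
    have w1 : (γ 1 0 : ℂ) * v 0 + (γ 1 1 : ℂ) * v 1 = 0 := congrFun hw 1
    funext i
    fin_cases i
    · change v 0 = 0
      linear_combination (γ 1 1 : ℂ) * w0 - (γ 0 1 : ℂ) * w1 - v 0 * hd
    · change v 1 = 0
      linear_combination (γ 0 0 : ℂ) * w1 - (γ 1 0 : ℂ) * w0 - v 1 * hd

end Models

/-! ### Factorization into linear forms, and independence of `R` from its choice. -/

section Factorization

/-- The linear form `β x - α y` attached to the pair `(α, β)`. -/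
def lin (v : ℂ × ℂ) : FormPoly ℂ := C v.2 * X 0 - C v.1 * X 1

/-- The factor of `R(F, z)` which comes from the linear form `β x - α y`. -/
def wt (z : HSpace) (v : ℂ × ℂ) : ℝ := (‖v.1 - v.2 * z.t‖ ^ 2 + ‖v.2‖ ^ 2 * z.u ^ 2) / z.u

theorem lin_smul (c : ℂ) (v : ℂ × ℂ) : lin (c • v) = C c * lin v := by
  simp only [lin, Prod.smul_snd, Prod.smul_fst, smul_eq_mul, C_mul]
  ring

theorem eval_lin (v w : ℂ × ℂ) : eval ![w.1, w.2] (lin v) = v.2 * w.1 - v.1 * w.2 := by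
  simp [lin]

theorem isHomogeneous_lin (v : ℂ × ℂ) : (lin v).IsHomogeneous 1 :=
  (isHomogeneous_C_mul_X _ _).sub (isHomogeneous_C_mul_X _ _)

theorem lin_ne_zero {v : ℂ × ℂ} (hv : v ≠ 0) : lin v ≠ 0 := by
  intro h
  apply hv
  have h1 := eval_lin v (1, 0)
  have h2 := eval_lin v (0, 1)
  rw [h] at h1 h2
  simp only [map_zero, mul_one, mul_zero, sub_zero, zero_sub] at h1 h2
  exact Prod.ext (neg_eq_zero.mp h2.symm) h1.symm

theorem wt_smul (z : HSpace) (c : ℂ) (v : ℂ × ℂ) : wt z (c • v) = ‖c‖ ^ 2 * wt z v := by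
  simp only [wt, Prod.smul_snd, Prod.smul_fst, smul_eq_mul]
  rw [show c * v.1 - c * v.2 * z.t = c * (v.1 - v.2 * z.t) by ring]
  simp only [norm_mul]
  ring

theorem exists_smul_eq_of_cross_eq_zero {p q : ℂ × ℂ} (hp : p ≠ 0)
    (h : q.2 * p.1 - q.1 * p.2 = 0) : ∃ e : ℂ, q = e • p := by
  by_cases h1 : p.1 = 0
  · have h2 : p.2 ≠ 0 := fun h2 => hp (Prod.ext h1 h2)
    have hq : q.1 = 0 := by
      simpa [h1, h2] using h
    refine ⟨q.2 / p.2, Prod.ext ?_ ?_⟩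
    · simp [h1, hq]
    · simp [h2]
  · refine ⟨q.1 / p.1, Prod.ext ?_ ?_⟩
    · simp [h1]
    · simp only [Prod.smul_snd, smul_eq_mul]
      field_simp
      linear_combination h

/-- Unique factorization by evaluation: the zero of a factor on the left kills some factor on the
right, which is then a multiple of it. Both are cancelled and the scalar passes into `c`. With `N =
wt z` this frees `bigR` from the factorization chosen in its definition. -/
theorem prod_eq_of_prod_lin_eq (N : ℂ × ℂ → ℝ) (hN : ∀ (c : ℂ) v, N (c • v) = ‖c‖ ^ 2 * N v)
    (S T : Multiset (ℂ × ℂ)) (hS : ∀ v ∈ S, v ≠ 0) (hT : ∀ v ∈ T, v ≠ 0) (c : ℂ) (hc : c ≠ 0)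
    (h : C c * (S.map lin).prod = (T.map lin).prod) :
    ‖c‖ ^ 2 * (S.map N).prod = (T.map N).prod := by
  induction S using Multiset.induction_on generalizing T c with
  | empty =>
    rcases T.empty_or_exists_mem with rfl | ⟨q, hq⟩
    · have : c = 1 := by
        simpa using congrArg (eval (0 : Fin 2 → ℂ)) h
      simp [this]
    · exfalso
      obtain ⟨T', rfl⟩ := Multiset.exists_cons_of_mem hq
      have := congrArg (eval ![q.1, q.2]) h
      simp only [Multiset.map_zero, Multiset.prod_zero, Multiset.map_cons, Multiset.prod_cons,
        map_mul, eval_lin, eval_C, map_one] at this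
      apply hc
      linear_combination this
  | cons p S ih =>
    have hp : p ≠ 0 := hS p (Multiset.mem_cons_self p S)
    have h0 : eval ![p.1, p.2] (T.map lin).prod = 0 := by
      rw [← h]
      simp only [Multiset.map_cons, Multiset.prod_cons, map_mul, eval_lin]
      ring
    rw [map_multiset_prod, Multiset.prod_eq_zero_iff] at h0
    simp only [Multiset.mem_map, exists_exists_and_eq_and, eval_lin] at h0
    obtain ⟨q, hq, hq0⟩ := h0
    obtain ⟨e, rfl⟩ := exists_smul_eq_of_cross_eq_zero hp hq0
    have he : e ≠ 0 := by
      rintro rfl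
      exact hT _ hq (zero_smul _ _)
    obtain ⟨T', rfl⟩ := Multiset.exists_cons_of_mem hq
    simp only [Multiset.map_cons, Multiset.prod_cons, lin_smul] at h
    have h' : C (c / e) * (S.map lin).prod = (T'.map lin).prod := by
      have hC : (C e * C (c / e) : FormPoly ℂ) = C c := by
        rw [← C_mul, mul_div_cancel₀ _ he]
      have hne : (C e : FormPoly ℂ) * lin p ≠ 0 :=
        mul_ne_zero (by simpa using he) (lin_ne_zero hp)
      apply mul_left_cancel₀ hne
      linear_combination h + lin p * (S.map lin).prod * hC
    have := ih T' (fun v hv => hS v (Multiset.mem_cons_of_mem hv))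
      (fun v hv => hT v (Multiset.mem_cons_of_mem hv)) (c / e) (div_ne_zero hc he) h'
    simp only [Multiset.map_cons, Multiset.prod_cons, hN]
    rw [← this, norm_div]
    have : ‖e‖ ≠ 0 := norm_ne_zero_iff.mpr he
    field_simp

variable {n : ℕ}

theorem prod_lin_ne_zero {p : Fin n → ℂ × ℂ} (hp : ∀ k, p k ≠ 0) : ∏ k, lin (p k) ≠ 0 :=
  Finset.prod_ne_zero_iff.mpr fun k _ => lin_ne_zero (hp k)

theorem isHomogeneous_prod_lin (p : Fin n → ℂ × ℂ) : (∏ k, lin (p k)).IsHomogeneous n := by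
  simpa using IsHomogeneous.prod Finset.univ (fun k => lin (p k)) (fun _ => 1)
    fun k _ => isHomogeneous_lin (p k)

theorem totalDegree_prod_lin {p : Fin n → ℂ × ℂ} (hp : ∀ k, p k ≠ 0) :
    (∏ k, lin (p k)).totalDegree = n :=
  (isHomogeneous_prod_lin p).totalDegree (prod_lin_ne_zero hp)

theorem bigR_prod_lin {p : Fin n → ℂ × ℂ} (hp : ∀ k, p k ≠ 0) (z : HSpace) :
    bigR (∏ k, lin (p k)) z = ∏ k, wt z (p k) := by
  have hdeg := totalDegree_prod_lin hp
  have hne := prod_lin_ne_zero hp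
  generalize hF : ∏ k, lin (p k) = F at *
  subst hdeg
  have h : ∃ p : (Fin F.totalDegree → ℂ) × (Fin F.totalDegree → ℂ),
      F = ∏ k, (C (p.2 k) * X 0 - C (p.1 k) * X 1) :=
    ⟨(fun k => (p k).1, fun k => (p k).2), hF.symm⟩
  rw [bigR, dif_pos h]
  set r := h.choose with hr
  have hr' : F = ∏ k, lin (r.1 k, r.2 k) := h.choose_spec
  have hr0 : ∀ k, (r.1 k, r.2 k) ≠ 0 := by
    intro k hk
    apply hne
    rw [hr']
    apply Finset.prod_eq_zero (Finset.mem_univ k)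
    rw [hk]
    simp [lin]
  have key := prod_eq_of_prod_lin_eq (wt z) (wt_smul z)
    (Finset.univ.val.map fun k => (r.1 k, r.2 k)) (Finset.univ.val.map p)
    (by simpa using hr0) (by simpa using hp) 1 one_ne_zero
    (by
      rw [Multiset.map_map, Multiset.map_map, C_1, one_mul]
      exact hr'.symm.trans hF.symm)
  rw [Multiset.map_map, Multiset.map_map, norm_one, one_pow, one_mul] at key
  exact key

theorem natDegree_aeval_X_one_le {F : FormPoly ℂ} {n : ℕ} (hF : F.IsHomogeneous n) :
    (aeval ![Polynomial.X, 1] F : Polynomial ℂ).natDegree ≤ n := by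
  rw [F.as_sum, map_sum]
  apply Polynomial.natDegree_sum_le_of_forall_le
  intro e he
  rw [aeval_monomial, Finsupp.prod_fintype _ _ (by simp), Fin.prod_univ_two]
  simp only [Matrix.cons_val_zero, Matrix.cons_val_one, one_pow, mul_one]
  have hw : e.degree = n := by
    by_contra h
    exact mem_support_iff.mp he (hF.coeff_eq_zero h)
  rw [Finsupp.degree_eq_sum, Fin.sum_univ_two] at hw
  refine (Polynomial.natDegree_C_mul_X_pow_le (coeff e F) (e 0)).trans ?_
  omega

theorem exists_multiset_of_isHomogeneous {F : FormPoly ℂ} {n : ℕ} (hF : F.IsHomogeneous n)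
    (hF0 : F ≠ 0) : ∃ (c : ℂ) (S : Multiset (ℂ × ℂ)), c ≠ 0 ∧ S.card = n ∧ (∀ v ∈ S, v ≠ 0) ∧
      F = C c * (S.map lin).prod := by
  set P : Polynomial ℂ := aeval ![Polynomial.X, 1] F with hP
  have hdeg : P.natDegree ≤ n := natDegree_aeval_X_one_le hF
  have hhom : P.homogenize n = F := Polynomial.homogenize_eq_of_isHomogeneous hF rfl
  have hP0 : P ≠ 0 := by
    intro h
    rw [h, Polynomial.homogenize_zero] at hhom
    exact hF0 hhom.symm
  have hsplit : P.Splits := IsAlgClosed.splits P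
  have hcard : P.roots.card = P.natDegree := hsplit.natDegree_eq_card_roots.symm
  -- The pair `(r, 1)` stands for `x - r y`. The pair `(-1, 0)` stands for `y`, once for each degree
  -- lost on setting `y = 1`.
  set S : Multiset (ℂ × ℂ) := P.roots.map (fun r => (r, 1)) +
    Multiset.replicate (n - P.natDegree) (-1, 0) with hSdef
  have hS : S.card = n := by
    rw [hSdef, Multiset.card_add, Multiset.card_map, Multiset.card_replicate, hcard]
    omega
  have hmap : ∀ r : ℂ, aeval ![Polynomial.X, 1] (lin (r, 1)) = Polynomial.X - Polynomial.C r := by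
    intro r
    simp [lin, Polynomial.C_eq_algebraMap]
  have hmap' : aeval ![Polynomial.X, 1] (lin (-1, 0)) = (1 : Polynomial ℂ) := by
    simp [lin]
  refine ⟨P.leadingCoeff, S, Polynomial.leadingCoeff_ne_zero.mpr hP0, hS, ?_, ?_⟩
  · intro v hv
    rw [hSdef, Multiset.mem_add, Multiset.mem_map] at hv
    rcases hv with ⟨r, -, rfl⟩ | hv
    · simp
    · rw [Multiset.eq_of_mem_replicate hv]
      simp
  · have h2 : (C P.leadingCoeff * (S.map lin).prod).IsHomogeneous n := by
      apply IsHomogeneous.C_mul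
      have : ∀ T : Multiset (ℂ × ℂ), (T.map lin).prod.IsHomogeneous T.card := by
        intro T
        induction T using Multiset.induction_on with
        | empty => simpa using isHomogeneous_one (Fin 2) ℂ
        | cons v T ih =>
          simpa [add_comm] using (isHomogeneous_lin v).mul ih
      exact hS ▸ this S
    rw [← hhom]
    apply Polynomial.homogenize_eq_of_isHomogeneous h2
    rw [map_mul, hSdef, Multiset.map_add, Multiset.prod_add, map_mul, map_multiset_prod,
      Multiset.map_map, Multiset.map_map, map_multiset_prod, Multiset.map_replicate,
      Multiset.map_replicate, Multiset.prod_replicate, hmap', one_pow, mul_one]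
    simp only [Function.comp_def, hmap]
    conv_rhs => rw [hsplit.eq_prod_roots]
    simp [Polynomial.C_eq_algebraMap]

theorem exists_prod_lin {F : FormPoly ℂ} {n : ℕ} (hn : n ≠ 0) (hF : F.IsHomogeneous n)
    (hF0 : F ≠ 0) : ∃ p : Fin n → ℂ × ℂ, (∀ k, p k ≠ 0) ∧ F = ∏ k, lin (p k) := by
  obtain ⟨c, S, hc, hcard, hS, rfl⟩ := exists_multiset_of_isHomogeneous hF hF0
  have hpos : 0 < S.card := by omega
  obtain ⟨v, hv⟩ := Multiset.card_pos_iff_exists_mem.mp hpos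
  obtain ⟨T, rfl⟩ := Multiset.exists_cons_of_mem hv
  obtain ⟨l, rfl⟩ := Quot.exists_rep T
  -- The leading constant is absorbed into one factor, which exists because `n ≠ 0`.
  set L : List (ℂ × ℂ) := (c • v) :: l with hL
  have hlen : L.length = n := by
    simpa [hL] using hcard
  have hL0 : ∀ w ∈ L, w ≠ 0 := by
    intro w hw
    rcases List.mem_cons.mp hw with rfl | hw
    · exact smul_ne_zero hc (hS v (Multiset.mem_cons_self _ _))
    · exact hS w (Multiset.mem_cons_of_mem (by simpa using hw))
  have hprod : (L.map lin).prod = ∏ k : Fin L.length, lin (L.get k) := by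
    simp only [List.get_eq_getElem, Fin.prod_univ_fun_getElem]
  subst hlen
  refine ⟨L.get, fun k => hL0 _ (L.get_mem k), ?_⟩
  rw [← hprod, hL]
  simp [lin_smul, mul_assoc]

end Factorization

/-! ### Equivariance of `R`, and distances to `j` in terms of matrix entries. -/

section Action

/-- The action on pairs which corresponds to the action on linear forms. -/
def vact (v : ℂ × ℂ) (M : SL(2, ℂ)) : ℂ × ℂ :=
  (v.1 * M 1 1 - v.2 * M 0 1, v.2 * M 0 0 - v.1 * M 1 0)

theorem substHom_lin (v : ℂ × ℂ) (M : SL(2, ℂ)) : substHom M (lin v) = lin (vact v M) := by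
  simp only [lin, vact, map_sub, map_mul, substHom_C, substHom_X]
  ring

theorem det_complex (M : SL(2, ℂ)) : M 0 0 * M 1 1 - M 0 1 * M 1 0 = 1 := by
  have := M.det_coe
  rwa [Matrix.det_fin_two] at this

theorem cross_vact (v w : ℂ × ℂ) (M : SL(2, ℂ)) :
    (vact v M).2 * (vact w M).1 - (vact v M).1 * (vact w M).2 = v.2 * w.1 - v.1 * w.2 := by
  simp only [vact]
  linear_combination (v.2 * w.1 - v.1 * w.2) * det_complex M

theorem vact_ne_zero {v : ℂ × ℂ} (hv : v ≠ 0) (M : SL(2, ℂ)) : vact v M ≠ 0 := by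
  intro h
  apply lin_ne_zero hv
  apply substHom_injective M
  rw [substHom_lin, h]
  simp [lin]

theorem substHom_prod_lin {n : ℕ} (p : Fin n → ℂ × ℂ) (M : SL(2, ℂ)) :
    substHom M (∏ k, lin (p k)) = ∏ k, lin (vact (p k) M) := by
  simp only [map_prod, substHom_lin]

/-- For the vectors `(s, c u)` and `(p, q u)` in `ℂ²`: the product of the squared norms is the
squared inner product plus the squared determinant. -/
theorem lagrange_identity (s c p q : ℂ) (u : ℝ) :
    (‖s‖ ^ 2 + ‖c‖ ^ 2 * u ^ 2) * (‖p‖ ^ 2 + ‖q‖ ^ 2 * u ^ 2) =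
      ‖p * star s + q * star c * (u : ℂ) ^ 2‖ ^ 2 + ‖s * q - c * p‖ ^ 2 * u ^ 2 := by
  simp only [Complex.sq_norm, Complex.normSq_apply]
  simp only [Complex.add_re, Complex.add_im,
    Complex.sub_re, Complex.sub_im, Complex.mul_re, Complex.mul_im, Complex.star_def,
    Complex.conj_re, Complex.conj_im, pow_two, Complex.ofReal_re, Complex.ofReal_im]
  ring

/-- `R(F · M, z) = R(F, M z)`, factor by factor. In the Lagrange identity the determinant gives the
term with `β` (`e1`) and the inner product gives `α - β t` at the image point (`e2`). -/
theorem wt_vact (z : HSpace) (v : ℂ × ℂ) (M : SL(2, ℂ)) : wt z (vact v M) = wt (moeb M z) v := by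
  have hu := z.u_pos
  have hD := denom_pos M z
  set s := M 1 0 * z.t + M 1 1 with hs
  set D := ‖s‖ ^ 2 + ‖M 1 0‖ ^ 2 * z.u ^ 2 with hDdef
  have hDc : (D : ℂ) ≠ 0 := by exact_mod_cast hD.ne'
  have hdet := det_complex M
  have key := lagrange_identity s (M 1 0) (v.1 * s - v.2 * (M 0 0 * z.t + M 0 1))
    (v.1 * M 1 0 - v.2 * M 0 0) z.u
  have hs2 : (D : ℂ) = s * star s + M 1 0 * star (M 1 0) * (z.u : ℂ) ^ 2 := by
    rw [hDdef]
    push_cast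
    simp only [Complex.star_def, Complex.mul_conj']
  have e1 : s * (v.1 * M 1 0 - v.2 * M 0 0) - M 1 0 * (v.1 * s - v.2 * (M 0 0 * z.t + M 0 1)) =
      -v.2 := by
    rw [hs]
    linear_combination (-v.2) * hdet
  have e2 : (v.1 * s - v.2 * (M 0 0 * z.t + M 0 1)) * star s +
      (v.1 * M 1 0 - v.2 * M 0 0) * star (M 1 0) * (z.u : ℂ) ^ 2 =
      D * (v.1 - v.2 * (moeb M z).t) := by
    have : D * (moeb M z).t =
        (M 0 0 * z.t + M 0 1) * star s + M 0 0 * star (M 1 0) * (z.u : ℂ) ^ 2 := by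
      simp only [moeb, ← hs, ← hDdef]
      field_simp
    linear_combination v.2 * this - v.1 * hs2
  rw [e1, e2, norm_mul, norm_neg, Complex.norm_real, Real.norm_of_nonneg hD.le] at key
  have e3 : (moeb M z).u = z.u / D := rfl
  have e4 : (vact v M).1 - (vact v M).2 * z.t = v.1 * s - v.2 * (M 0 0 * z.t + M 0 1) := by
    simp only [vact, hs]
    ring
  have e5 : ‖(vact v M).2‖ = ‖v.1 * M 1 0 - v.2 * M 0 0‖ := by
    rw [← norm_neg]
    simp [vact]
  rw [wt, wt, e3, e4, e5]
  have hD0 := hD.ne'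
  field_simp
  rw [← hDdef] at key
  linarith

theorem coshToJ_moeb (M : SL(2, ℂ)) (z : HSpace) :
    coshToJ (moeb M z) = (‖M 0 0 * z.t + M 0 1‖ ^ 2 + ‖M 0 0‖ ^ 2 * z.u ^ 2 +
      (‖M 1 0 * z.t + M 1 1‖ ^ 2 + ‖M 1 0‖ ^ 2 * z.u ^ 2)) / (2 * z.u) := by
  have hu := z.u_pos
  have hD := denom_pos M z
  set s := M 1 0 * z.t + M 1 1 with hs
  set D := ‖s‖ ^ 2 + ‖M 1 0‖ ^ 2 * z.u ^ 2 with hDdef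
  have key := lagrange_identity s (M 1 0) (M 0 0 * z.t + M 0 1) (M 0 0) z.u
  have e1 : s * M 0 0 - M 1 0 * (M 0 0 * z.t + M 0 1) = 1 := by
    rw [hs]
    linear_combination det_complex M
  rw [e1, norm_one, ← hDdef] at key
  have e2 : (moeb M z).u = z.u / D := rfl
  have e3 : ‖(moeb M z).t‖ = ‖(M 0 0 * z.t + M 0 1) * star s +
      M 0 0 * star (M 1 0) * (z.u : ℂ) ^ 2‖ / D := by
    simp only [moeb, ← hs, ← hDdef]
    rw [norm_div, Complex.norm_real, Real.norm_of_nonneg hD.le]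
  rw [coshToJ, e2, e3]
  have hD0 := hD.ne'
  field_simp
  linarith

/-- Half the squared Frobenius norm, which inversion preserves. Hence `M j` and `M⁻¹ j` are equally
far from `j`, the only invariance of the distance that is needed. -/
theorem coshToJ_moeb_jPt (M : SL(2, ℂ)) :
    coshToJ (moeb M jPt) = (‖M 0 0‖ ^ 2 + ‖M 0 1‖ ^ 2 + ‖M 1 0‖ ^ 2 + ‖M 1 1‖ ^ 2) / 2 := by
  rw [coshToJ_moeb]
  simp only [jPt, mul_zero, zero_add]
  ring

theorem coshToJ_moeb_inv_jPt (M : SL(2, ℂ)) :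
    coshToJ (moeb M⁻¹ jPt) = coshToJ (moeb M jPt) := by
  rw [coshToJ_moeb_jPt, coshToJ_moeb_jPt]
  simp only [Matrix.SpecialLinearGroup.SL2_inv_expl, Matrix.cons_val', Matrix.cons_val_zero,
    Matrix.cons_val_one, Matrix.cons_val_fin_one, norm_neg]
  ring

theorem toPt_00 (z : HSpace) : toPt z 0 0 = Real.sqrt z.u := rfl

theorem toPt_01 (z : HSpace) : toPt z 0 1 = z.t / Real.sqrt z.u := rfl

theorem toPt_10 (z : HSpace) : toPt z 1 0 = 0 := rfl

theorem toPt_11 (z : HSpace) : toPt z 1 1 = 1 / Real.sqrt z.u := rfl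

theorem coshToJ_moeb_eq (M : SL(2, ℂ)) (z : HSpace) :
    coshToJ (moeb M z) = coshToJ (moeb (M * toPt z) jPt) := by
  have hu := z.u_pos
  have hs : (Real.sqrt z.u) ≠ 0 := (Real.sqrt_pos.mpr hu).ne'
  have hsc : (Real.sqrt z.u : ℂ) ≠ 0 := by exact_mod_cast hs
  have hs2 : Real.sqrt z.u ^ 2 = z.u := Real.sq_sqrt hu.le
  have hn : ‖(Real.sqrt z.u : ℂ)‖ = Real.sqrt z.u := by
    rw [Complex.norm_real, Real.norm_of_nonneg (Real.sqrt_nonneg _)]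
  have e0 : ∀ i, (M * toPt z) i 0 = M i 0 * Real.sqrt z.u := by
    intro i
    rw [Matrix.SpecialLinearGroup.coe_mul, Matrix.mul_apply, Fin.sum_univ_two, toPt_00, toPt_10,
      mul_zero, add_zero]
  have e1 : ∀ i, (M * toPt z) i 1 = (M i 0 * z.t + M i 1) / Real.sqrt z.u := by
    intro i
    rw [Matrix.SpecialLinearGroup.coe_mul, Matrix.mul_apply, Fin.sum_univ_two, toPt_01, toPt_11]
    field_simp
  rw [coshToJ_moeb_jPt, coshToJ_moeb, e0, e0, e1, e1]
  simp only [norm_mul, norm_div, hn, mul_pow, div_pow, hs2]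
  field_simp
  ring

theorem moeb_toPt (z w : HSpace) :
    moeb (toPt z) w = ⟨z.t + z.u * w.t, z.u * w.u, mul_pos z.u_pos w.u_pos⟩ := by
  have hu := z.u_pos
  have hs : (Real.sqrt z.u) ≠ 0 := (Real.sqrt_pos.mpr hu).ne'
  have hsc : (Real.sqrt z.u : ℂ) ≠ 0 := by exact_mod_cast hs
  have hs2 : Real.sqrt z.u ^ 2 = z.u := Real.sq_sqrt hu.le
  have hs2c : (Real.sqrt z.u : ℂ) ^ 2 = z.u := by exact_mod_cast hs2
  have hD : ‖(toPt z) 1 0 * w.t + (toPt z) 1 1‖ ^ 2 + ‖(toPt z) 1 0‖ ^ 2 * w.u ^ 2 = 1 / z.u := by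
    simp [toPt, hs2]
  have huc : (z.u : ℂ) ≠ 0 := by exact_mod_cast hu.ne'
  ext1
  · simp only [moeb]
    rw [hD]
    simp only [toPt, Matrix.SpecialLinearGroup.coe_mk, Matrix.of_apply, Matrix.cons_val', Matrix.cons_val_zero,
      Matrix.cons_val_one, Matrix.cons_val_fin_one, zero_mul, zero_add, star_zero, mul_zero,
      add_zero]
    simp only [Complex.star_def, map_div₀, map_one, Complex.conj_ofReal]
    push_cast
    field_simp
    linear_combination (-z.t) * hs2c
  · simp only [moeb]
    rw [hD]
    field_simp

end Action

/-! ### The inequality `R(F, j) ≤ 2 ^ (n - 1) ‖F‖`. -/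

section LowerSizeBound

theorem size_eq_sum {F : FormPoly ℂ} {s : Finset (Fin 2 →₀ ℕ)} (h : F.support ⊆ s) :
    size F = ∑ e ∈ s, ‖F.coeff e‖ ^ 2 := by
  rw [size]
  apply Finset.sum_subset h
  intro e _ he
  rw [notMem_support_iff.mp he]
  simp

theorem size_X_mul (i : Fin 2) (Q : FormPoly ℂ) : size (X i * Q) = size Q := by
  rw [size, support_X_mul, Finset.sum_map, size]
  apply Finset.sum_congr rfl
  intro e _
  rw [addLeftEmbedding_apply, coeff_X_mul]

/-- The pair whose linear form is the reflection of the one of `v` in the unit circle. -/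
def flip (v : ℂ × ℂ) : ℂ × ℂ := (star v.2, star v.1)

theorem norm_sq_sub_flip (a b x y : ℂ) :
    ‖b * x - a * y‖ ^ 2 = ‖star a * x - star b * y‖ ^ 2 + (‖b‖ ^ 2 - ‖a‖ ^ 2) *
      (‖x‖ ^ 2 - ‖y‖ ^ 2) := by
  simp only [Complex.sq_norm, Complex.normSq_apply]
  simp only [Complex.sub_re, Complex.sub_im, Complex.mul_re, Complex.mul_im, Complex.star_def,
    Complex.conj_re, Complex.conj_im]
  ring

/-- By `norm_sq_sub_flip` the two sizes differ by a multiple of `size (X 0 * Q) - size (X 1 * Q)`,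
and multiplication by a variable only shifts coefficients. On the unit torus the two linear forms
have equal absolute values. -/
theorem size_lin_flip_mul (v : ℂ × ℂ) (Q : FormPoly ℂ) :
    size (lin (flip v) * Q) = size (lin v * Q) := by
  classical
  set s := (lin v * Q).support ∪ (lin (flip v) * Q).support ∪ (X 0 * Q).support ∪
    (X 1 * Q).support with hs
  have h1 : (lin v * Q).support ⊆ s := fun e he => by simp only [hs, Finset.mem_union]; tauto
  have h2 : (lin (flip v) * Q).support ⊆ s := fun e he => by
    simp only [hs, Finset.mem_union]; tauto
  have h3 : (X 0 * Q).support ⊆ s := fun e he => by simp only [hs, Finset.mem_union]; tauto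
  have h4 : (X 1 * Q).support ⊆ s := fun e he => by simp only [hs, Finset.mem_union]; tauto
  have hc : ∀ (w : ℂ × ℂ) e, coeff e (lin w * Q) =
      w.2 * coeff e (X 0 * Q) - w.1 * coeff e (X 1 * Q) := by
    intro w e
    rw [lin, sub_mul, coeff_sub, mul_assoc, mul_assoc, coeff_C_mul, coeff_C_mul]
  have h5 : ∑ e ∈ s, (‖v.2‖ ^ 2 - ‖v.1‖ ^ 2) *
      (‖coeff e (X 0 * Q)‖ ^ 2 - ‖coeff e (X 1 * Q)‖ ^ 2) = 0 := by
    rw [← Finset.mul_sum, Finset.sum_sub_distrib, ← size_eq_sum h3, ← size_eq_sum h4, size_X_mul,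
      size_X_mul, sub_self, mul_zero]
  rw [size_eq_sum h1, size_eq_sum h2]
  simp only [hc]
  conv_rhs => enter [2, e]; rw [norm_sq_sub_flip]
  rw [Finset.sum_add_distrib, h5, add_zero]
  rfl

theorem size_prod_lin_mul_congr {ι : Type*} (s : Finset ι) (p q : ι → ℂ × ℂ)
    (h : ∀ k ∈ s, q k = p k ∨ q k = flip (p k)) (Q : FormPoly ℂ) :
    size ((∏ k ∈ s, lin (q k)) * Q) = size ((∏ k ∈ s, lin (p k)) * Q) := by
  classical
  induction s using Finset.induction_on generalizing Q with
  | empty => simp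
  | insert a s ha ih =>
    have ih := ih fun k hk => h k (Finset.mem_insert_of_mem hk)
    rw [Finset.prod_insert ha, Finset.prod_insert ha]
    calc size (lin (q a) * (∏ k ∈ s, lin (q k)) * Q)
        = size ((∏ k ∈ s, lin (q k)) * (lin (q a) * Q)) := by ring_nf
      _ = size ((∏ k ∈ s, lin (p k)) * (lin (q a) * Q)) := ih _
      _ = size (lin (q a) * ((∏ k ∈ s, lin (p k)) * Q)) := by ring_nf
      _ = size (lin (p a) * ((∏ k ∈ s, lin (p k)) * Q)) := by
        rcases h a (Finset.mem_insert_self a s) with h | h <;> rw [h]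
        exact size_lin_flip_mul _ _
      _ = _ := by ring_nf

theorem coeff_single_zero_prod_lin {ι : Type*} (s : Finset ι) (p : ι → ℂ × ℂ) :
    coeff (Finsupp.single 0 s.card) (∏ k ∈ s, lin (p k)) = ∏ k ∈ s, (p k).2 := by
  classical
  induction s using Finset.induction_on with
  | empty => simp
  | insert a s ha ih =>
    rw [Finset.prod_insert ha, Finset.prod_insert ha, Finset.card_insert_of_notMem ha, ← ih, lin,
      sub_mul, coeff_sub, mul_assoc, mul_assoc, coeff_C_mul, coeff_C_mul, coeff_X_mul',
      coeff_X_mul']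
    simp

theorem coeff_single_one_prod_lin {ι : Type*} (s : Finset ι) (p : ι → ℂ × ℂ) :
    coeff (Finsupp.single 1 s.card) (∏ k ∈ s, lin (p k)) = ∏ k ∈ s, -(p k).1 := by
  classical
  induction s using Finset.induction_on with
  | empty => simp
  | insert a s ha ih =>
    rw [Finset.prod_insert ha, Finset.prod_insert ha, Finset.card_insert_of_notMem ha, ← ih, lin,
      sub_mul, coeff_sub, mul_assoc, mul_assoc, coeff_C_mul, coeff_C_mul, coeff_X_mul',
      coeff_X_mul']
    simp

theorem add_sq_le_size_prod_lin {n : ℕ} (hn : n ≠ 0) (p : Fin n → ℂ × ℂ) :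
    ∏ k, ‖(p k).2‖ ^ 2 + ∏ k, ‖(p k).1‖ ^ 2 ≤ size (∏ k, lin (p k)) := by
  classical
  set F := ∏ k, lin (p k) with hF
  have h0 := coeff_single_zero_prod_lin Finset.univ p
  have h1 := coeff_single_one_prod_lin Finset.univ p
  rw [Finset.card_univ, Fintype.card_fin, ← hF] at h0 h1
  have hne : Finsupp.single (0 : Fin 2) n ≠ Finsupp.single 1 n := by
    intro h
    have := DFunLike.congr_fun h 0
    simp [hn] at this
  rw [size_eq_sum (Finset.subset_union_left (s₂ := {Finsupp.single 0 n, Finsupp.single 1 n}))]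
  refine le_trans (le_of_eq ?_) (Finset.sum_le_sum_of_subset_of_nonneg
    Finset.subset_union_right fun _ _ _ => by positivity)
  rw [Finset.sum_pair hne, h0, h1]
  simp [Finset.prod_pow]

/-- Chebyshev's inequality `(a + b) (A + B) ≤ 2 (a A + b B)` for `b ≤ a`, `B ≤ A`, iterated. -/
theorem two_mul_prod_add_le {ι : Type*} (s : Finset ι) (a b : ι → ℝ)
    (hb : ∀ k ∈ s, 0 ≤ b k) (hab : ∀ k ∈ s, b k ≤ a k) :
    2 * ∏ k ∈ s, (a k + b k) ≤ 2 ^ s.card * (∏ k ∈ s, a k + ∏ k ∈ s, b k) := by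
  classical
  induction s using Finset.induction_on with
  | empty => norm_num
  | insert i s hi ih =>
    rw [Finset.forall_mem_insert] at hb hab
    have ih := ih hb.2 hab.2
    rw [Finset.prod_insert hi, Finset.prod_insert hi, Finset.prod_insert hi,
      Finset.card_insert_of_notMem hi, pow_succ]
    have hAB : ∏ k ∈ s, b k ≤ ∏ k ∈ s, a k := Finset.prod_le_prod hb.2 hab.2
    calc 2 * ((a i + b i) * ∏ k ∈ s, (a k + b k))
        = (a i + b i) * (2 * ∏ k ∈ s, (a k + b k)) := by ring
      _ ≤ (a i + b i) * (2 ^ s.card * (∏ k ∈ s, a k + ∏ k ∈ s, b k)) :=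
        mul_le_mul_of_nonneg_left ih (by linarith [hb.1, hab.1])
      _ = 2 ^ s.card * ((a i + b i) * (∏ k ∈ s, a k + ∏ k ∈ s, b k)) := by ring
      _ ≤ 2 ^ s.card * (2 * (a i * ∏ k ∈ s, a k + b i * ∏ k ∈ s, b k)) := by
        apply mul_le_mul_of_nonneg_left _ (by positivity)
        nlinarith [mul_nonneg (sub_nonneg.mpr hab.1) (sub_nonneg.mpr hAB)]
      _ = _ := by ring

theorem wt_jPt (v : ℂ × ℂ) : wt jPt v = ‖v.2‖ ^ 2 + ‖v.1‖ ^ 2 := by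
  simp [wt, jPt, add_comm]

theorem bigR_jPt_le_size {n : ℕ} (hn : n ≠ 0) {p : Fin n → ℂ × ℂ} (hp : ∀ k, p k ≠ 0) :
    bigR (∏ k, lin (p k)) jPt ≤ 2 ^ (n - 1) * size (∏ k, lin (p k)) := by
  classical
  rw [bigR_prod_lin hp]
  -- Flipping changes neither the size nor `R(·, j)`, and it arranges `|α_k| ≤ |β_k|` for all `k`,
  -- as Chebyshev's inequality requires.
  set q : Fin n → ℂ × ℂ := fun k => if ‖(p k).1‖ ≤ ‖(p k).2‖ then p k else flip (p k) with hq
  have hsize : size (∏ k, lin (q k)) = size (∏ k, lin (p k)) := by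
    have := size_prod_lin_mul_congr Finset.univ p q (by
      intro k _
      by_cases h : ‖(p k).1‖ ≤ ‖(p k).2‖
      · left; simp [hq, h]
      · right; simp only [hq, h, if_false]) 1
    simpa using this
  have hwt : ∀ k, wt jPt (p k) = ‖(q k).2‖ ^ 2 + ‖(q k).1‖ ^ 2 := by
    intro k
    rw [wt_jPt]
    by_cases h : ‖(p k).1‖ ≤ ‖(p k).2‖
    · simp [hq, h]
    · simp only [hq, h, if_false, flip, norm_star]
      ring
  have hle : ∀ k, ‖(q k).1‖ ≤ ‖(q k).2‖ := by
    intro k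
    by_cases h : ‖(p k).1‖ ≤ ‖(p k).2‖
    · simp [hq, h]
    · simp only [hq, h, if_false, flip, norm_star]
      exact (not_le.mp h).le
  have h1 := two_mul_prod_add_le Finset.univ (fun k => ‖(q k).2‖ ^ 2) (fun k => ‖(q k).1‖ ^ 2)
    (fun k _ => by positivity) (fun k _ => pow_le_pow_left₀ (norm_nonneg _) (hle k) 2)
  have h2 := add_sq_le_size_prod_lin hn q
  simp only [hwt]
  rw [Finset.card_univ, Fintype.card_fin] at h1
  rw [hsize] at h2
  obtain ⟨m, rfl⟩ := Nat.exists_eq_succ_of_ne_zero hn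
  rw [Nat.succ_sub_one]
  rw [show (2 : ℝ) ^ m.succ = 2 ^ m * 2 from pow_succ _ _] at h1
  have h3 : (0 : ℝ) < 2 ^ m := by positivity
  have h4 := mul_le_mul_of_nonneg_left h2 h3.le
  linarith

end LowerSizeBound

/-! ### Stability in terms of linear factors. -/

section StableFamilies

variable {n : ℕ}

/-- The determinant of two pairs; it vanishes iff the linear forms are proportional. -/
def cross (v w : ℂ × ℂ) : ℂ := v.2 * w.1 - v.1 * w.2

/-- The product `∏ R(β_k x - α_k y, z)` for a family of pairs `(α_k, β_k)`. -/
def famR (p : Fin n → ℂ × ℂ) (z : HSpace) : ℝ := ∏ k, wt z (p k)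

/-- A family of nonzero pairs such that fewer than half of them are proportional. -/
def StableFam (p : Fin n → ℂ × ℂ) : Prop :=
  (∀ k, p k ≠ 0) ∧ ∀ S : Finset (Fin n),
    (∀ k ∈ S, ∀ l ∈ S, cross (p k) (p l) = 0) → 2 * S.card < n

theorem IsStable.ne_zero {F : FormPoly ℂ} (hF : IsStable F) : F ≠ 0 := by
  rintro rfl
  exact hF.2 1 0 (by simp) 0 (by simp) (dvd_zero _)

theorem IsStable.totalDegree_ne_zero {F : FormPoly ℂ} (hF : IsStable F) : F.totalDegree ≠ 0 := by
  intro h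
  exact hF.2 1 0 (by simp) 0 (by simp [h]) (by simp)

theorem stableFam_of_isStable {p : Fin n → ℂ × ℂ} (hp : ∀ k, p k ≠ 0)
    (h : IsStable (∏ k, lin (p k))) : StableFam p := by
  classical
  refine ⟨hp, fun S hS => ?_⟩
  have hdeg := totalDegree_prod_lin hp
  have hn := h.totalDegree_ne_zero
  rw [hdeg] at hn
  rcases S.eq_empty_or_nonempty with rfl | ⟨k₀, hk₀⟩
  · simpa using Nat.pos_of_ne_zero hn
  · by_contra hcard
    rw [not_lt] at hcard
    have hab : ((p k₀).2, -(p k₀).1) ≠ (0, 0) := by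
      intro h0
      rw [Prod.mk.injEq, neg_eq_zero] at h0
      exact hp k₀ (Prod.ext h0.2 h0.1)
    apply h.2 _ _ hab S.card (by rwa [hdeg])
    have hdvd : ∏ k ∈ S, lin (p k₀) ∣ ∏ k ∈ S, lin (p k) := by
      apply Finset.prod_dvd_prod_of_dvd
      intro k hk
      have hc := hS k hk k₀ hk₀
      have hk0 : p k ≠ 0 := hp k
      obtain ⟨e, he⟩ := exists_smul_eq_of_cross_eq_zero hk0 (q := p k₀) (by
        rw [cross] at hc
        linear_combination -hc)
      have he0 : e ≠ 0 := by
        rintro rfl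
        exact hp k₀ (by simpa using he)
      rw [he, lin_smul]
      refine ⟨C e⁻¹, ?_⟩
      have : (C e * C e⁻¹ : FormPoly ℂ) = 1 := by
        rw [← C_mul, mul_inv_cancel₀ he0, C_1]
      linear_combination (-lin (p k)) * this
    rw [Finset.prod_const] at hdvd
    have hlin : (C (p k₀).2 * X 0 + C (-(p k₀).1) * X 1 : FormPoly ℂ) = lin (p k₀) := by
      rw [lin, C_neg]
      ring
    rw [hlin]
    exact hdvd.trans (Finset.prod_dvd_prod_of_subset _ _ _ (Finset.subset_univ S))

theorem StableFam.vact {p : Fin n → ℂ × ℂ} (hp : StableFam p) (M : SL(2, ℂ)) :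
    StableFam fun k => vact (p k) M := by
  refine ⟨fun k => vact_ne_zero (hp.1 k) M, fun S hS => hp.2 S fun k hk l hl => ?_⟩
  have := hS k hk l hl
  rwa [cross, cross_vact] at this

theorem wt_pos (z : HSpace) {v : ℂ × ℂ} (hv : v ≠ 0) : 0 < wt z v := by
  have hu := z.u_pos
  apply div_pos _ hu
  by_cases h2 : v.2 = 0
  · have h1 : v.1 ≠ 0 := fun h1 => hv (Prod.ext h1 h2)
    have := norm_pos_iff.mpr h1
    simp only [h2, zero_mul, sub_zero, norm_zero]
    positivity
  · have := norm_pos_iff.mpr h2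
    positivity

theorem famR_pos {p : Fin n → ℂ × ℂ} (hp : ∀ k, p k ≠ 0) (z : HSpace) : 0 < famR p z :=
  Finset.prod_pos fun k _ => wt_pos z (hp k)

theorem famR_vact (p : Fin n → ℂ × ℂ) (M : SL(2, ℂ)) (z : HSpace) :
    famR (fun k => vact (p k) M) z = famR p (moeb M z) := by
  simp only [famR, wt_vact]

end StableFamilies

/-! ### Growth of `R` at infinity. -/

section Coercivity

variable {n : ℕ}

theorem one_le_coshToJ (z : HSpace) : 1 ≤ coshToJ z := by
  have hu := z.u_pos
  rw [coshToJ, one_le_div (by positivity)]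
  nlinarith [sq_nonneg (z.u - 1), sq_nonneg ‖z.t‖]

theorem coshToJ_jPt : coshToJ jPt = 1 := by
  simp [coshToJ, jPt]

theorem eq_jPt_of_coshToJ_eq_one {z : HSpace} (h : coshToJ z = 1) : z = jPt := by
  have hu := z.u_pos
  rw [coshToJ, div_eq_one_iff_eq (by positivity)] at h
  have h1 : ‖z.t‖ ^ 2 = 0 := by nlinarith [sq_nonneg (z.u - 1), sq_nonneg ‖z.t‖]
  have h2 : (z.u - 1) ^ 2 = 0 := by nlinarith [sq_nonneg (z.u - 1), sq_nonneg ‖z.t‖]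
  ext1
  · simpa [jPt] using h1
  · have : z.u - 1 = 0 := by simpa using h2
    simp only [jPt]
    linarith

theorem hdist_jPt (z : HSpace) : hdist z jPt = Real.arcosh (coshToJ z) := by
  have hu := z.u_pos
  rw [hdist, coshToJ]
  congr 1
  simp only [jPt, sub_zero]
  field_simp
  ring

theorem div_le_wt (z : HSpace) (v : ℂ × ℂ) :
    (‖v.1‖ ^ 2 + ‖v.2‖ ^ 2) / (2 * coshToJ z) ≤ wt z v := by
  have hu := z.u_pos
  have hc := one_le_coshToJ z
  rw [div_le_iff₀ (by positivity), wt, coshToJ]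
  set w := v.1 - v.2 * z.t with hw
  have h1 : ‖v.1‖ ≤ ‖w‖ + ‖v.2‖ * ‖z.t‖ := by
    rw [← norm_mul]
    have : v.1 = w + v.2 * z.t := by rw [hw]; ring
    calc ‖v.1‖ = ‖w + v.2 * z.t‖ := by rw [← this]
      _ ≤ _ := norm_add_le _ _
  have h2 : ‖v.1‖ ^ 2 ≤ (‖w‖ + ‖v.2‖ * ‖z.t‖) ^ 2 := pow_le_pow_left₀ (norm_nonneg _) h1 2
  have e : (‖w‖ ^ 2 + ‖v.2‖ ^ 2 * z.u ^ 2) / z.u * (2 * ((‖z.t‖ ^ 2 + z.u ^ 2 + 1) / (2 * z.u))) =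
      (‖w‖ ^ 2 + ‖v.2‖ ^ 2 * z.u ^ 2) * (‖z.t‖ ^ 2 + z.u ^ 2 + 1) / z.u ^ 2 := by
    field_simp
  rw [e, le_div_iff₀ (by positivity)]
  nlinarith [sq_nonneg (‖w‖ * ‖z.t‖ - ‖v.2‖ * z.u ^ 2), sq_nonneg ‖w‖,
    mul_le_mul_of_nonneg_right h2 (sq_nonneg z.u)]

theorem norm_sq_sub_le (a b : ℂ) : ‖a - b‖ ^ 2 ≤ 2 * (‖a‖ ^ 2 + ‖b‖ ^ 2) := by
  have h := pow_le_pow_left₀ (norm_nonneg _) (norm_sub_le a b) 2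
  nlinarith [sq_nonneg (‖a‖ - ‖b‖)]

/-- Two independent linear forms cannot both be small. Cramer's rule recovers `t`, `1` and `u`, up
to the determinant `D`, from the quantities that enter the two factors. -/
theorem exists_le_wt_add_wt {v w : ℂ × ℂ} (h : cross v w ≠ 0) :
    ∃ c : ℝ, 0 < c ∧ ∀ z, c * coshToJ z ≤ wt z v + wt z w := by
  set D := cross v w with hD
  have hD0 : 0 < ‖D‖ ^ 2 := by
    have := norm_pos_iff.mpr h
    positivity
  set B := ‖v.1‖ ^ 2 + ‖v.2‖ ^ 2 + ‖w.1‖ ^ 2 + ‖w.2‖ ^ 2 + 1 with hB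
  have hBpos : 0 < B := by positivity
  -- Each of the three Cramer identities costs a factor `2`; the `2 * z.u` in `coshToJ` halves the
  -- total `6`.
  refine ⟨‖D‖ ^ 2 / (3 * B), by positivity, fun z => ?_⟩
  have hu := z.u_pos
  set a := v.1 - v.2 * z.t with ha
  set b := w.1 - w.2 * z.t with hb
  have e1 : D * z.t = b * v.1 - a * w.1 := by
    rw [hD, cross, ha, hb]; ring
  have e2 : D = b * v.2 - a * w.2 := by
    rw [hD, cross, ha, hb]; ring
  have e3 : D * z.u = (v.2 * z.u) * w.1 - (w.2 * z.u) * v.1 := by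
    rw [hD, cross]; ring
  have hun : ‖(z.u : ℂ)‖ = z.u := by rw [Complex.norm_real, Real.norm_of_nonneg hu.le]
  have f1 := norm_sq_sub_le (b * v.1) (a * w.1)
  have f2 := norm_sq_sub_le (b * v.2) (a * w.2)
  have f3 := norm_sq_sub_le ((v.2 * z.u) * w.1) ((w.2 * z.u) * v.1)
  rw [← e1] at f1
  rw [← e2] at f2
  rw [← e3] at f3
  simp only [norm_mul, hun, mul_pow] at f1 f2 f3
  have hsum : wt z v + wt z w =
      (‖a‖ ^ 2 + ‖v.2‖ ^ 2 * z.u ^ 2 + (‖b‖ ^ 2 + ‖w.2‖ ^ 2 * z.u ^ 2)) / z.u := by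
    rw [wt, wt, ← add_div]
  rw [hsum, coshToJ, div_mul_div_comm, div_le_div_iff₀ (by positivity) hu]
  set Q := ‖a‖ ^ 2 + ‖v.2‖ ^ 2 * z.u ^ 2 + (‖b‖ ^ 2 + ‖w.2‖ ^ 2 * z.u ^ 2) with hQ
  have g : ∀ x y s r : ℝ, 0 ≤ x → 0 ≤ y → 0 ≤ s → 0 ≤ r → x + y ≤ Q → s ≤ B → r ≤ B →
      x * s + y * r ≤ Q * B := by
    intro x y s r hx hy hs hr hxy hsB hrB
    have := mul_le_mul_of_nonneg_left hsB hx
    have := mul_le_mul_of_nonneg_left hrB hy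
    have := mul_le_mul_of_nonneg_right hxy hBpos.le
    linarith
  have p1 : 0 ≤ ‖v.1‖ ^ 2 := by positivity
  have p2 : 0 ≤ ‖v.2‖ ^ 2 := by positivity
  have p3 : 0 ≤ ‖w.1‖ ^ 2 := by positivity
  have p4 : 0 ≤ ‖w.2‖ ^ 2 := by positivity
  have p5 : 0 ≤ ‖a‖ ^ 2 := by positivity
  have p6 : 0 ≤ ‖b‖ ^ 2 := by positivity
  have p7 : 0 ≤ ‖v.2‖ ^ 2 * z.u ^ 2 := by positivity
  have p8 : 0 ≤ ‖w.2‖ ^ 2 * z.u ^ 2 := by positivity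
  have g1 := g (‖a‖ ^ 2) (‖b‖ ^ 2) (‖w.1‖ ^ 2) (‖v.1‖ ^ 2) p5 p6 p3 p1 (by linarith)
    (by linarith) (by linarith)
  have g2 := g (‖b‖ ^ 2) (‖a‖ ^ 2) (‖v.2‖ ^ 2) (‖w.2‖ ^ 2) p6 p5 p2 p4 (by linarith)
    (by linarith) (by linarith)
  have g3 := g (‖v.2‖ ^ 2 * z.u ^ 2) (‖w.2‖ ^ 2 * z.u ^ 2) (‖w.1‖ ^ 2) (‖v.1‖ ^ 2) p7 p8 p3 p1
    (by linarith) (by linarith) (by linarith)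
  have : ‖D‖ ^ 2 * (‖z.t‖ ^ 2 + z.u ^ 2 + 1) ≤ 6 * (Q * B) := by linarith
  nlinarith [mul_le_mul_of_nonneg_right this hu.le]

theorem exists_pos_le_of_finite {ι : Type*} [Finite ι] (f : ι → ℝ) (hf : ∀ i, 0 < f i) :
    ∃ c : ℝ, 0 < c ∧ ∀ i, c ≤ f i := by
  rcases isEmpty_or_nonempty ι with h | h
  · exact ⟨1, one_pos, fun i => (h.false i).elim⟩
  · obtain ⟨i, hi⟩ := Finite.exists_min f
    exact ⟨f i, hf i, hi⟩

/-- Write `K = coshToJ z`. The factors below `c K` are pairwise proportional, so they are fewer than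
`n / 2`. Each of them is still at least `c / K`, so the large factors win by at least one power of
`K`. -/
theorem StableFam.coercive {p : Fin n → ℂ × ℂ} (hp : StableFam p) :
    ∃ c : ℝ, 0 < c ∧ ∀ z, c * coshToJ z ≤ famR p z := by
  classical
  have h1 : ∀ kl : Fin n × Fin n, ∃ c : ℝ, 0 < c ∧ (cross (p kl.1) (p kl.2) ≠ 0 →
      ∀ z, c * coshToJ z ≤ wt z (p kl.1) + wt z (p kl.2)) := by
    intro kl
    by_cases h : cross (p kl.1) (p kl.2) = 0
    · exact ⟨1, one_pos, fun h' => absurd h h'⟩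
    · obtain ⟨c, hc, hc'⟩ := exists_le_wt_add_wt h
      exact ⟨c, hc, fun _ => hc'⟩
  choose f hf hf' using h1
  obtain ⟨c₁, hc₁, hc₁'⟩ := exists_pos_le_of_finite f hf
  obtain ⟨c₂, hc₂, hc₂'⟩ := exists_pos_le_of_finite (fun k => (‖(p k).1‖ ^ 2 + ‖(p k).2‖ ^ 2) / 2)
    (fun k => by
      have := wt_pos jPt (hp.1 k)
      rw [wt_jPt] at this
      linarith)
  set c := min (c₁ / 2) c₂ with hc
  have hcpos : 0 < c := lt_min (by linarith) hc₂
  refine ⟨c ^ n, by positivity, fun z => ?_⟩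
  have hK := one_le_coshToJ z
  set K := coshToJ z with hKdef
  have hK0 : 0 < K := by linarith
  set S : Finset (Fin n) := Finset.univ.filter fun k => wt z (p k) < c * K with hS
  have hScard : 2 * S.card < n := by
    apply hp.2
    intro k hk l hl
    by_contra hkl
    have h2 := hf' (k, l) hkl z
    have h3 := hc₁' (k, l)
    have h4 := (Finset.mem_filter.mp hk).2
    have h5 := (Finset.mem_filter.mp hl).2
    have h6 : c ≤ c₁ / 2 := min_le_left _ _
    rw [← hKdef] at h2
    nlinarith
  have hcompl : Sᶜ.card = n - S.card := by
    rw [Finset.card_compl, Fintype.card_fin]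
  have hlow : ∀ k ∈ S, c / K ≤ wt z (p k) := by
    intro k _
    refine le_trans ?_ (div_le_wt z (p k))
    have h6 : c ≤ c₂ := min_le_right _ _
    have h7 := hc₂' k
    rw [← hKdef, div_le_div_iff₀ hK0 (by positivity)]
    nlinarith
  have hhigh : ∀ k ∈ Sᶜ, c * K ≤ wt z (p k) := by
    intro k hk
    simpa [hS] using hk
  have h8 : (c / K) ^ S.card ≤ ∏ k ∈ S, wt z (p k) := by
    rw [← Finset.prod_const]
    exact Finset.prod_le_prod (fun _ _ => by positivity) hlow
  have h9 : (c * K) ^ (n - S.card) ≤ ∏ k ∈ Sᶜ, wt z (p k) := by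
    rw [← hcompl, ← Finset.prod_const]
    exact Finset.prod_le_prod (fun _ _ => by positivity) hhigh
  rw [famR, ← Finset.prod_mul_prod_compl S]
  refine le_trans ?_ (mul_le_mul h8 h9 (by positivity) (le_trans (by positivity) h8))
  -- The surplus `r + 1` of large over small factors is positive because stability is strict.
  obtain ⟨r, hr⟩ : ∃ r, n = S.card + (S.card + (r + 1)) := ⟨n - 2 * S.card - 1, by omega⟩
  have e : n - S.card = S.card + (r + 1) := by omega
  rw [e]
  have : (c / K) ^ S.card * (c * K) ^ (S.card + (r + 1)) = c ^ n * (K ^ r * K) := by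
    conv_rhs => rw [hr]
    rw [div_pow]
    field_simp
    ring
  rw [this]
  have hKr : 1 ≤ K ^ r := one_le_pow₀ hK
  apply mul_le_mul_of_nonneg_left _ (by positivity)
  nlinarith

end Coercivity

/-! ### Compactness of balls and existence of extremal points. -/

section Compactness

variable {n : ℕ}

/-- The points `t + u j` with `coshToJ (t + u j) ≤ B`, as a subset of `ℂ × ℝ`. -/
def coshBall (B : ℝ) : Set (ℂ × ℝ) := {q | ‖q.1‖ ^ 2 + q.2 ^ 2 + 1 ≤ 2 * B * q.2}

theorem pos_of_mem_coshBall {B : ℝ} (hB : 0 < B) {q : ℂ × ℝ} (hq : q ∈ coshBall B) : 0 < q.2 := by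
  have h : ‖q.1‖ ^ 2 + q.2 ^ 2 + 1 ≤ 2 * B * q.2 := hq
  by_contra hneg
  rw [not_lt] at hneg
  nlinarith [sq_nonneg ‖q.1‖, sq_nonneg q.2, mul_nonneg hB.le (neg_nonneg.mpr hneg)]

theorem mem_coshBall (B : ℝ) (z : HSpace) : (z.t, z.u) ∈ coshBall B ↔ coshToJ z ≤ B := by
  have hu := z.u_pos
  rw [coshToJ, div_le_iff₀ (by positivity)]
  simp only [coshBall, Set.mem_ofPred_eq]
  rw [show 2 * B * z.u = B * (2 * z.u) by ring]

theorem isCompact_coshBall {B : ℝ} (hB : 0 < B) : IsCompact (coshBall B) := by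
  apply Metric.isCompact_of_isClosed_isBounded
  · exact isClosed_le (by fun_prop) (by fun_prop)
  · rw [isBounded_iff_forall_norm_le]
    refine ⟨2 * B, fun q hq => ?_⟩
    have hu := pos_of_mem_coshBall hB hq
    have h : ‖q.1‖ ^ 2 + q.2 ^ 2 + 1 ≤ 2 * B * q.2 := hq
    have h1 : q.2 ≤ 2 * B := by nlinarith [sq_nonneg ‖q.1‖]
    have h2 : ‖q.1‖ ≤ 2 * B := by
      apply abs_le_of_sq_le_sq' _ (by positivity) |>.2
      nlinarith [sq_nonneg q.2]
    rw [Prod.norm_def, Real.norm_of_nonneg hu.le]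
    exact max_le h2 h1

/-- The function `famR` in the coordinates `t`, `u`. -/
def famRCoord (p : Fin n → ℂ × ℂ) (q : ℂ × ℝ) : ℝ :=
  ∏ k, (‖(p k).1 - (p k).2 * q.1‖ ^ 2 + ‖(p k).2‖ ^ 2 * q.2 ^ 2) / q.2

theorem famRCoord_eq (p : Fin n → ℂ × ℂ) (z : HSpace) : famRCoord p (z.t, z.u) = famR p z := rfl

theorem continuousOn_famRCoord (p : Fin n → ℂ × ℂ) {B : ℝ} (hB : 0 < B) :
    ContinuousOn (famRCoord p) (coshBall B) := by
  apply continuousOn_finsetProd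
  intro k _
  apply ContinuousOn.div (by fun_prop) (by fun_prop)
  intro q hq
  exact (pos_of_mem_coshBall hB hq).ne'

theorem StableFam.exists_minimizer {p : Fin n → ℂ × ℂ} (hp : StableFam p) :
    ∃ z, ∀ w, famR p z ≤ famR p w := by
  obtain ⟨c, hc, hc'⟩ := hp.coercive
  set B := famR p jPt / c with hB
  have hB1 : 1 ≤ B := by
    rw [hB, one_le_div hc]
    simpa [coshToJ_jPt] using hc' jPt
  have hB0 : 0 < B := by linarith
  have hj : ((jPt.t, jPt.u) : ℂ × ℝ) ∈ coshBall B := by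
    rw [mem_coshBall, coshToJ_jPt]
    exact hB1
  obtain ⟨q, hq, hmin⟩ := (isCompact_coshBall hB0).exists_isMinOn ⟨_, hj⟩
    (continuousOn_famRCoord p hB0)
  refine ⟨⟨q.1, q.2, pos_of_mem_coshBall hB0 hq⟩, fun w => ?_⟩
  by_cases hw : coshToJ w ≤ B
  · rw [← famRCoord_eq, ← famRCoord_eq]
    exact isMinOn_iff.mp hmin _ ((mem_coshBall B w).mpr hw)
  · have h1 : famR p ⟨q.1, q.2, pos_of_mem_coshBall hB0 hq⟩ ≤ famR p jPt := by
      rw [← famRCoord_eq, ← famRCoord_eq]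
      exact isMinOn_iff.mp hmin _ hj
    refine h1.trans (le_trans ?_ (hc' w))
    rw [not_le, hB, div_lt_iff₀ hc] at hw
    linarith

theorem isClosed_coord {P : Set HSpace} (hP : P = Set.univ ∨ P = realPlane) :
    ∃ T : Set (ℂ × ℝ), IsClosed T ∧ ∀ z : HSpace, (z.t, z.u) ∈ T ↔ z ∈ P := by
  rcases hP with rfl | rfl
  · exact ⟨Set.univ, isClosed_univ, fun z => by simp⟩
  · exact ⟨{q | q.1.im = 0}, isClosed_eq (by fun_prop) (by fun_prop), fun z => Iff.rfl⟩

/-- Coercivity makes sublevel sets of `R` compact. Their farthest points show that `ε` is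
surjective. -/
theorem StableFam.exists_max_coshToJ {p : Fin n → ℂ × ℂ} (hp : StableFam p) {P : Set HSpace}
    (hP : P = Set.univ ∨ P = realPlane) {s : ℝ} (hne : ∃ z ∈ P, famR p z ≤ s) :
    ∃ z ∈ P, famR p z ≤ s ∧ ∀ w ∈ P, famR p w ≤ s → coshToJ w ≤ coshToJ z := by
  obtain ⟨c, hc, hc'⟩ := hp.coercive
  obtain ⟨T, hT, hTP⟩ := isClosed_coord hP
  set B := s / c with hB
  have hle : ∀ z, famR p z ≤ s → coshToJ z ≤ B := by
    intro z hz
    rw [hB, le_div_iff₀ hc]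
    linarith [hc' z]
  obtain ⟨z₀, hz₀, hz₀'⟩ := hne
  have hB0 : 0 < B := by linarith [one_le_coshToJ z₀, hle z₀ hz₀']
  have hcl : IsClosed (coshBall B ∩ famRCoord p ⁻¹' Set.Iic s) :=
    (continuousOn_famRCoord p hB0).preimage_isClosed_of_isClosed
      (isCompact_coshBall hB0).isClosed isClosed_Iic
  have hcomp : IsCompact (coshBall B ∩ famRCoord p ⁻¹' Set.Iic s ∩ T) :=
    (isCompact_coshBall hB0).of_isClosed_subset (hcl.inter hT)
      (Set.inter_subset_left.trans Set.inter_subset_left)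
  have hcont : ContinuousOn (fun q : ℂ × ℝ => (‖q.1‖ ^ 2 + q.2 ^ 2 + 1) / (2 * q.2))
      (coshBall B ∩ famRCoord p ⁻¹' Set.Iic s ∩ T) := by
    apply ContinuousOn.div (by fun_prop) (by fun_prop)
    intro q hq
    have := pos_of_mem_coshBall hB0 hq.1.1
    positivity
  have hmem : ∀ z ∈ P, famR p z ≤ s →
      ((z.t, z.u) : ℂ × ℝ) ∈ coshBall B ∩ famRCoord p ⁻¹' Set.Iic s ∩ T := fun z hz hzs =>
    ⟨⟨(mem_coshBall B z).mpr (hle z hzs), by rwa [Set.mem_preimage, famRCoord_eq]⟩, (hTP z).mpr hz⟩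
  obtain ⟨q, hq, hmax⟩ := hcomp.exists_isMaxOn ⟨_, hmem z₀ hz₀ hz₀'⟩ hcont
  refine ⟨⟨q.1, q.2, pos_of_mem_coshBall hB0 hq.1.1⟩, (hTP _).mp hq.2, ?_, ?_⟩
  · rw [← famRCoord_eq]
    exact hq.1.2
  · intro w hw hws
    exact isMaxOn_iff.mp hmax _ (hmem w hw hws)

end Compactness

/-! ### Geodesic rays from `j`. -/

section Rays

/-- The point at distance `s` from `j` in the direction `(x, y)` of the unit sphere. -/
def rayPt (x : ℝ) (y : ℂ) (h : x ^ 2 + ‖y‖ ^ 2 = 1) (s : ℝ) : HSpace where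
  t := y * Real.sinh s / ((Real.cosh s - x * Real.sinh s : ℝ) : ℂ)
  u := 1 / (Real.cosh s - x * Real.sinh s)
  u_pos := by
    apply one_div_pos.mpr
    have h1 : x ^ 2 ≤ 1 := by nlinarith [sq_nonneg ‖y‖]
    have h2 := Real.cosh_sq s
    have h3 := Real.cosh_pos s
    have h4 : (x * Real.sinh s) ^ 2 < Real.cosh s ^ 2 := by
      nlinarith [mul_le_mul_of_nonneg_right h1 (sq_nonneg (Real.sinh s))]
    have := (abs_lt_of_sq_lt_sq' h4 h3.le).2
    linarith

theorem cosh_sub_pos {x : ℝ} {y : ℂ} (h : x ^ 2 + ‖y‖ ^ 2 = 1) (s : ℝ) :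
    0 < Real.cosh s - x * Real.sinh s :=
  one_div_pos.mp (rayPt x y h s).u_pos

theorem norm_rayPt_t {x : ℝ} {y : ℂ} (h : x ^ 2 + ‖y‖ ^ 2 = 1) (s : ℝ) :
    ‖(rayPt x y h s).t‖ ^ 2 =
      ‖y‖ ^ 2 * Real.sinh s ^ 2 / (Real.cosh s - x * Real.sinh s) ^ 2 := by
  simp only [rayPt, norm_div, norm_mul, Complex.norm_real, div_pow, mul_pow, Real.norm_eq_abs,
    sq_abs]

theorem coshToJ_rayPt {x : ℝ} {y : ℂ} (h : x ^ 2 + ‖y‖ ^ 2 = 1) (s : ℝ) :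
    coshToJ (rayPt x y h s) = Real.cosh s := by
  have hW := cosh_sub_pos h s
  have hW0 := hW.ne'
  have hc := Real.cosh_sq s
  have hu : (rayPt x y h s).u = 1 / (Real.cosh s - x * Real.sinh s) := rfl
  rw [coshToJ, norm_rayPt_t, hu]
  have hy : ‖y‖ ^ 2 = 1 - x ^ 2 := by linarith
  rw [hy]
  field_simp
  nlinarith

theorem rayPt_zero {x : ℝ} {y : ℂ} (h : x ^ 2 + ‖y‖ ^ 2 = 1) : rayPt x y h 0 = jPt :=
  eq_jPt_of_coshToJ_eq_one (by rw [coshToJ_rayPt, Real.cosh_zero])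

/-- The coefficient of `exp s` in the value at `rayPt x y h s` of the factor of `v`. -/
def rayCoeff (x : ℝ) (y : ℂ) (v : ℂ × ℂ) : ℝ :=
  (‖(1 - x) * v.1 - v.2 * y‖ ^ 2 + ‖(1 + x) * v.2 - v.1 * star y‖ ^ 2) / 4

theorem rayCoeff_nonneg (x : ℝ) (y : ℂ) (v : ℂ × ℂ) : 0 ≤ rayCoeff x y v := by
  rw [rayCoeff]
  positivity

/-- For a unit direction, a vanishing coefficient means that the root `α / β` is the end point of
the ray, so two such forms are proportional. -/
theorem cross_eq_zero_of_rayCoeff {x : ℝ} {y : ℂ} {v w : ℂ × ℂ} (hv : rayCoeff x y v = 0)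
    (hw : rayCoeff x y w = 0) : cross v w = 0 := by
  have key : ∀ v : ℂ × ℂ, rayCoeff x y v = 0 →
      (1 - x) * v.1 = v.2 * y ∧ (1 + x) * v.2 = v.1 * star y := by
    intro v hv
    rw [rayCoeff] at hv
    have h1 : ‖(1 - x) * v.1 - v.2 * y‖ ^ 2 = 0 := by
      nlinarith [sq_nonneg ‖(1 - x) * v.1 - v.2 * y‖, sq_nonneg ‖(1 + x) * v.2 - v.1 * star y‖]
    have h2 : ‖(1 + x) * v.2 - v.1 * star y‖ ^ 2 = 0 := by
      nlinarith [sq_nonneg ‖(1 - x) * v.1 - v.2 * y‖, sq_nonneg ‖(1 + x) * v.2 - v.1 * star y‖]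
    rw [sq_eq_zero_iff, norm_eq_zero, sub_eq_zero] at h1 h2
    exact ⟨h1, h2⟩
  obtain ⟨v1, v2⟩ := key v hv
  obtain ⟨w1, w2⟩ := key w hw
  have : (2 : ℂ) * cross v w = 0 := by
    rw [cross]
    linear_combination v.2 * w1 - w.2 * v1 + w.1 * v2 - v.1 * w2
  simpa using this

theorem wt_rayPt {x : ℝ} {y : ℂ} (h : x ^ 2 + ‖y‖ ^ 2 = 1) (s : ℝ) (v : ℂ × ℂ) :
    wt (rayPt x y h s) v =
      rayCoeff x y v * Real.exp s + rayCoeff (-x) (-y) v * Real.exp (-s) := by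
  have hW := cosh_sub_pos h s
  set W := Real.cosh s - x * Real.sinh s with hWdef
  have hW0 := hW.ne'
  have hWc : (W : ℂ) ≠ 0 := by exact_mod_cast hW0
  have hc := Real.cosh_sq s
  have hu : (rayPt x y h s).u = 1 / W := rfl
  have ht : v.1 - v.2 * (rayPt x y h s).t = (W * v.1 - v.2 * y * Real.sinh s) / W := by
    have : (rayPt x y h s).t = y * Real.sinh s / (W : ℂ) := rfl
    rw [this]
    field_simp
  have hnW : ‖(W : ℂ)‖ = W := by rw [Complex.norm_real, Real.norm_of_nonneg hW.le]
  rw [wt, ht, hu, norm_div, hnW]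
  have hdiv : ∀ X N : ℝ, (X / W ^ 2 + N * (1 / W) ^ 2) / (1 / W) = (X + N) / W := by
    intro X N
    field_simp
  rw [div_pow, hdiv, div_eq_iff hW0]
  have hexp : Real.exp s = Real.cosh s + Real.sinh s := (Real.cosh_add_sinh s).symm
  have hexp' : Real.exp (-s) = Real.cosh s - Real.sinh s := (Real.cosh_sub_sinh s).symm
  rw [hexp, hexp', rayCoeff, rayCoeff]
  rw [Complex.sq_norm, Complex.normSq_apply] at h
  simp only [Complex.sq_norm, Complex.normSq_apply]
  simp only [Complex.sub_re, Complex.sub_im, Complex.add_re, Complex.add_im, Complex.mul_re,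
    Complex.mul_im, Complex.ofReal_re, Complex.ofReal_im, Complex.neg_re, Complex.neg_im,
    Complex.one_re, Complex.one_im, Complex.star_def, Complex.conj_re, Complex.conj_im,
    Complex.ofReal_neg]
  rw [hWdef]
  linear_combination
    ((v.2.re * v.2.re + v.2.im * v.2.im) * Real.sinh s ^ 2 -
      (Real.cosh s - x * Real.sinh s) * (v.1.re * v.1.re + v.1.im * v.1.im +
        (v.2.re * v.2.re + v.2.im * v.2.im)) * Real.cosh s / 2) * h -
    (v.2.re * v.2.re + v.2.im * v.2.im) * hc

theorem exists_rayPt_eq {P : Set HSpace} (hP : P = Set.univ ∨ P = realPlane) {w : HSpace}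
    (hw : w ∈ P) : ∃ (x : ℝ) (y : ℂ) (h : x ^ 2 + ‖y‖ ^ 2 = 1) (s : ℝ),
      0 ≤ s ∧ w = rayPt x y h s ∧ ∀ r, rayPt x y h r ∈ P := by
  have hmem : ∀ (x : ℝ) (y : ℂ) (h : x ^ 2 + ‖y‖ ^ 2 = 1) (r : ℝ), (w.t.im = 0 → y.im = 0) →
      rayPt x y h r ∈ P := by
    intro x y h r hy
    rcases hP with rfl | rfl
    · trivial
    · have := hy hw
      change ((y * Real.sinh r / ((Real.cosh r - x * Real.sinh r : ℝ) : ℂ)) : ℂ).im = 0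
      rw [Complex.div_ofReal_im, Complex.im_mul_ofReal, this, zero_mul, zero_div]
  have hK := one_le_coshToJ w
  rcases hK.eq_or_lt with hK1 | hK1
  · have hwj := eq_jPt_of_coshToJ_eq_one hK1.symm
    refine ⟨1, 0, by simp, 0, le_rfl, ?_, fun r => hmem _ _ _ _ fun _ => rfl⟩
    rw [rayPt_zero, hwj]
  · have hu := w.u_pos
    set K := coshToJ w with hKdef
    set s := Real.arcosh K with hs
    have hs0 : 0 < s := Real.arcosh_pos hK1
    have hcs : Real.cosh s = K := Real.cosh_arcosh hK
    have hS : 0 < Real.sinh s := Real.sinh_pos_iff.mpr hs0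
    set S := Real.sinh s with hSdef
    have hS2 : K ^ 2 = S ^ 2 + 1 := by rw [← hcs, hSdef]; exact Real.cosh_sq s
    have hKu : K * (2 * w.u) = ‖w.t‖ ^ 2 + w.u ^ 2 + 1 := by
      rw [hKdef, coshToJ]
      field_simp
    have hn : ‖w.t / ((w.u * S : ℝ) : ℂ)‖ = ‖w.t‖ / (w.u * S) := by
      rw [norm_div, Complex.norm_real, Real.norm_of_nonneg (by positivity)]
    have hxy : ((K - 1 / w.u) / S) ^ 2 + ‖w.t / ((w.u * S : ℝ) : ℂ)‖ ^ 2 = 1 := by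
      rw [hn]
      field_simp
      nlinarith
    have hW : Real.cosh s - (K - 1 / w.u) / S * Real.sinh s = 1 / w.u := by
      rw [hcs, ← hSdef]
      field_simp
      ring
    -- The direction solves the formulas of `rayPt` for `x` and `y`. A real `w.t` gives a real `y`,
    -- so the whole ray stays in the upper half-plane.
    refine ⟨(K - 1 / w.u) / S, w.t / ((w.u * S : ℝ) : ℂ), hxy, s, hs0.le, ?_, fun r =>
      hmem _ _ _ _ fun him => by rw [Complex.div_ofReal_im, him, zero_div]⟩
    have hSc : (S : ℂ) ≠ 0 := by exact_mod_cast hS.ne'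
    have huc : (w.u : ℂ) ≠ 0 := by exact_mod_cast hu.ne'
    ext1
    · simp only [rayPt]
      rw [hW, ← hSdef]
      push_cast
      field_simp
    · simp only [rayPt]
      rw [hW, one_div_one_div]

end Rays

/-! ### Convexity of `R` along rays and uniqueness of the minimizer. -/

section Convexity

variable {n : ℕ}

/-- The expanded product is a nonnegative combination of exponentials. The factor `exp (m s)` serves
the induction: each new factor shifts `m` by `±1`. -/
theorem convexOn_exp_mul_prod {ι : Type*} (S : Finset ι) (A B : ι → ℝ) (hA : ∀ k, 0 ≤ A k)
    (hB : ∀ k, 0 ≤ B k) (m : ℝ) : ConvexOn ℝ Set.univ fun s : ℝ =>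
      Real.exp (m * s) * ∏ k ∈ S, (A k * Real.exp s + B k * Real.exp (-s)) := by
  classical
  induction S using Finset.induction_on generalizing m with
  | empty =>
    simp only [Finset.prod_empty, mul_one]
    exact convexOn_exp.comp_linearMap (LinearMap.mulLeft ℝ m)
  | insert a S ha ih =>
    have h := ((ih (m + 1)).smul (hA a)).add ((ih (m - 1)).smul (hB a))
    refine h.congr fun s _ => ?_
    simp only [Pi.add_apply, smul_eq_mul, Finset.prod_insert ha]
    rw [show (m + 1) * s = m * s + s by ring, show (m - 1) * s = m * s + -s by ring, Real.exp_add,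
      Real.exp_add]
    ring

theorem famR_rayPt (p : Fin n → ℂ × ℂ) {x : ℝ} {y : ℂ} (h : x ^ 2 + ‖y‖ ^ 2 = 1) (s : ℝ) :
    famR p (rayPt x y h s) = ∏ k, (rayCoeff x y (p k) * Real.exp s +
      rayCoeff (-x) (-y) (p k) * Real.exp (-s)) := by
  simp only [famR, wt_rayPt]

theorem convexOn_famR_rayPt (p : Fin n → ℂ × ℂ) {x : ℝ} {y : ℂ} (h : x ^ 2 + ‖y‖ ^ 2 = 1) :
    ConvexOn ℝ Set.univ fun s => famR p (rayPt x y h s) := by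
  have := convexOn_exp_mul_prod Finset.univ (fun k => rayCoeff x y (p k))
    (fun k => rayCoeff (-x) (-y) (p k)) (fun k => rayCoeff_nonneg _ _ _)
    (fun k => rayCoeff_nonneg _ _ _) 0
  simp only [zero_mul, Real.exp_zero, one_mul] at this
  simpa only [famR_rayPt] using this

theorem continuous_famR_rayPt (p : Fin n → ℂ × ℂ) {x : ℝ} {y : ℂ} (h : x ^ 2 + ‖y‖ ^ 2 = 1) :
    Continuous fun s => famR p (rayPt x y h s) := by
  simp only [famR_rayPt]
  fun_prop

/-- Strict log-convexity at the midpoint `m` of `j` and `w` gives `R(m) ^ 2 < R(j) R(w)`, which with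
`R(j) ≤ R(m)` forces `R(j) < R(w)`. -/
theorem StableFam.lt_of_ne_jPt {p : Fin n → ℂ × ℂ} (hp : StableFam p)
    (hmin : ∀ w, famR p jPt ≤ famR p w) {w : HSpace} (hw : w ≠ jPt) : famR p jPt < famR p w := by
  classical
  obtain ⟨x, y, h, s, hs, rfl, -⟩ := exists_rayPt_eq (Or.inl rfl) (Set.mem_univ w)
  have hs0 : 0 < s := by
    rcases hs.eq_or_lt with rfl | hs
    · exact absurd (rayPt_zero h) hw
    · exact hs
  set r := s / 2 with hr
  have hr0 : 0 < r := by positivity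
  by_contra hle
  rw [not_lt] at hle
  set A := fun k => rayCoeff x y (p k) with hA
  set B := fun k => rayCoeff (-x) (-y) (p k) with hB
  have hA0 : ∀ k, 0 ≤ A k := fun k => rayCoeff_nonneg _ _ _
  have hB0 : ∀ k, 0 ≤ B k := fun k => rayCoeff_nonneg _ _ _
  have hwt : ∀ q k, wt (rayPt x y h q) (p k) = A k * Real.exp q + B k * Real.exp (-q) := fun q k =>
    wt_rayPt h q (p k)
  have hj : ∀ k, wt jPt (p k) = A k + B k := by
    intro k
    rw [← rayPt_zero h, hwt]
    simp
  have hdiff : ∀ k, wt jPt (p k) * wt (rayPt x y h s) (p k) - wt (rayPt x y h r) (p k) ^ 2 =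
      A k * B k * (Real.exp r - Real.exp (-r)) ^ 2 := by
    intro k
    rw [hj, hwt, hwt, show s = r + r by rw [hr]; ring, neg_add, Real.exp_add, Real.exp_add]
    have : Real.exp r * Real.exp (-r) = 1 := by rw [← Real.exp_add]; simp
    ring
  have hexp : 0 < (Real.exp r - Real.exp (-r)) ^ 2 := by
    have : Real.exp (-r) < Real.exp r := Real.exp_lt_exp.mpr (by linarith)
    have : 0 < Real.exp r - Real.exp (-r) := by linarith
    positivity
  -- Otherwise every root is an end point of the geodesic, and by stability each end carries fewer
  -- than `n / 2` of them.
  have hex : ∃ k, 0 < A k * B k := by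
    by_contra hno
    push Not at hno
    have hAB : ∀ k, A k = 0 ∨ B k = 0 := by
      intro k
      exact mul_eq_zero.mp (le_antisymm (hno k) (mul_nonneg (hA0 k) (hB0 k)))
    have h1 := hp.2 (Finset.univ.filter fun k => A k = 0) (by
      intro k hk l hl
      exact cross_eq_zero_of_rayCoeff (Finset.mem_filter.mp hk).2 (Finset.mem_filter.mp hl).2)
    have h2 := hp.2 (Finset.univ.filter fun k => B k = 0) (by
      intro k hk l hl
      exact cross_eq_zero_of_rayCoeff (Finset.mem_filter.mp hk).2 (Finset.mem_filter.mp hl).2)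
    have h3 : (Finset.univ : Finset (Fin n)) ⊆
        (Finset.univ.filter fun k => A k = 0) ∪ (Finset.univ.filter fun k => B k = 0) := by
      intro k _
      simpa using hAB k
    have h4 := (Finset.card_le_card h3).trans (Finset.card_union_le _ _)
    rw [Finset.card_univ, Fintype.card_fin] at h4
    omega
  obtain ⟨k, hk⟩ := hex
  have hlt : ∏ k, wt (rayPt x y h r) (p k) ^ 2 <
      ∏ k, wt jPt (p k) * wt (rayPt x y h s) (p k) := by
    apply Finset.prod_lt_prod
    · intro l _
      have := wt_pos (rayPt x y h r) (hp.1 l)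
      positivity
    · intro l _
      have := mul_nonneg (mul_nonneg (hA0 l) (hB0 l)) hexp.le
      linarith [hdiff l]
    · refine ⟨k, Finset.mem_univ k, ?_⟩
      have := mul_pos hk hexp
      linarith [hdiff k]
  rw [Finset.prod_pow, Finset.prod_mul_distrib] at hlt
  change famR p _ ^ 2 < famR p _ * famR p _ at hlt
  have h1 := hmin (rayPt x y h r)
  have h2 := famR_pos hp.1 jPt
  nlinarith

theorem moeb_toPt_jPt (z : HSpace) : moeb (toPt z) jPt = z := by
  rw [moeb_toPt]
  simp [jPt]

theorem exists_moeb_toPt_eq (z w : HSpace) : ∃ w', moeb (toPt z) w' = w := by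
  have hz := z.u_pos
  have hw := w.u_pos
  have hzc : (z.u : ℂ) ≠ 0 := by exact_mod_cast hz.ne'
  refine ⟨⟨(w.t - z.t) / z.u, w.u / z.u, div_pos hw hz⟩, ?_⟩
  rw [moeb_toPt]
  ext1
  · simp only
    field_simp
    ring
  · simp only
    field_simp

theorem StableFam.minimizer_unique {p : Fin n → ℂ × ℂ} (hp : StableFam p) {z : HSpace}
    (hmin : ∀ w, famR p z ≤ famR p w) {w : HSpace} (hw : ∀ w', famR p w ≤ famR p w') : w = z := by
  obtain ⟨w', rfl⟩ := exists_moeb_toPt_eq z w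
  by_contra hne
  have hw' : w' ≠ jPt := by
    rintro rfl
    exact hne (moeb_toPt_jPt z)
  have hlt := (hp.vact (toPt z)).lt_of_ne_jPt (by
    intro q
    rw [famR_vact, famR_vact, moeb_toPt_jPt]
    exact hmin _) hw'
  rw [famR_vact, famR_vact, moeb_toPt_jPt] at hlt
  exact absurd (hw z) (not_le.mpr hlt)

end Convexity

/-! ### The function `ε`: comparison with `R` and surjectivity. -/

section Epsilon

variable {n : ℕ}

/-- The infimum which defines `ε` for a form with the factors `p`. -/
def epsFam (P : Set HSpace) (p : Fin n → ℂ × ℂ) (δ : ℝ) : ℝ :=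
  sInf ((fun w => famR p w / famR p jPt) '' {w | w ∈ P ∧ hdist w jPt = δ})

theorem epsFam_le {P : Set HSpace} {p : Fin n → ℂ × ℂ} (hp : ∀ k, p k ≠ 0) {w : HSpace}
    (hw : w ∈ P) : epsFam P p (hdist w jPt) ≤ famR p w / famR p jPt := by
  apply csInf_le
  · refine ⟨0, ?_⟩
    rintro _ ⟨q, -, rfl⟩
    exact (div_pos (famR_pos hp _) (famR_pos hp _)).le
  · exact ⟨w, ⟨hw, rfl⟩, rfl⟩

theorem hdist_rayPt {x : ℝ} {y : ℂ} (h : x ^ 2 + ‖y‖ ^ 2 = 1) {s : ℝ} (hs : 0 ≤ s) :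
    hdist (rayPt x y h s) jPt = s := by
  rw [hdist_jPt, coshToJ_rayPt, Real.arcosh_cosh hs]

theorem StableFam.epsFam_lt {P : Set HSpace} (hP : P = Set.univ ∨ P = realPlane)
    {p : Fin n → ℂ × ℂ} (hp : StableFam p) (hmin : ∀ w, famR p jPt ≤ famR p w) {w : HSpace}
    (hw : w ∈ P) {δ : ℝ} (hδ : 0 ≤ δ) (hlt : Real.cosh δ < coshToJ w) :
    epsFam P p δ < famR p w / famR p jPt := by
  obtain ⟨x, y, h, s, hs, rfl, hray⟩ := exists_rayPt_eq hP hw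
  rw [coshToJ_rayPt, Real.cosh_lt_cosh, abs_of_nonneg hδ, abs_of_nonneg hs] at hlt
  have h1 := epsFam_le hp.1 (hray δ)
  rw [hdist_rayPt h hδ] at h1
  refine h1.trans_lt ?_
  apply div_lt_div_of_pos_right _ (famR_pos hp.1 _)
  have hs0 : 0 < s := by linarith
  have hne : rayPt x y h s ≠ jPt := by
    intro he
    have := hdist_rayPt h hs
    have h0 := hdist_rayPt h (le_refl 0)
    rw [rayPt_zero] at h0
    rw [he] at this
    linarith
  have h2 := hp.lt_of_ne_jPt hmin hne
  have hl : δ / s < 1 := (div_lt_one hs0).mpr hlt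
  have hl0 : 0 ≤ δ / s := by positivity
  -- The point of the same ray at distance `δ` bounds the infimum. Convexity on `[0, s]` and the
  -- strict minimum at `0` put its value below that at `s`.
  have h3 := (convexOn_famR_rayPt p h).2 (Set.mem_univ 0) (Set.mem_univ s)
    (sub_nonneg.mpr hl.le) hl0 (by ring)
  simp only [smul_eq_mul, mul_zero, zero_add, rayPt_zero] at h3
  rw [div_mul_cancel₀ _ hs0.ne'] at h3
  nlinarith

/-- Take `δ` to be the distance of the farthest point with `R ≤ s R(j)`. A point at that distance
with `R < s R(j)` could be pushed farther along its ray by continuity, so the minimum there is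
exactly `s`. -/
theorem StableFam.exists_epsFam_eq {P : Set HSpace} (hP : P = Set.univ ∨ P = realPlane)
    {p : Fin n → ℂ × ℂ} (hp : StableFam p) {s : ℝ} (hs : 1 ≤ s) :
    ∃ δ, 0 ≤ δ ∧ epsFam P p δ = s := by
  have hj := famR_pos hp.1 jPt
  have hjP : jPt ∈ P := by
    rcases hP with rfl | rfl
    · trivial
    · change jPt.t.im = 0
      simp [jPt]
  obtain ⟨z, hzP, hzs, hmax⟩ := hp.exists_max_coshToJ hP (s := s * famR p jPt)
    ⟨jPt, hjP, by nlinarith⟩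
  refine ⟨hdist z jPt, ?_, le_antisymm ?_ ?_⟩
  · rw [hdist_jPt]
    exact Real.arcosh_nonneg (one_le_coshToJ z)
  · exact (epsFam_le hp.1 hzP).trans ((div_le_iff₀ hj).mpr hzs)
  · have hne : {w | w ∈ P ∧ hdist w jPt = hdist z jPt}.Nonempty := ⟨z, hzP, rfl⟩
    apply le_csInf (hne.image _)
    rintro _ ⟨w, ⟨hwP, hwd⟩, rfl⟩
    by_contra hlt
    simp only [not_le] at hlt
    rw [div_lt_iff₀ hj] at hlt
    obtain ⟨x, y, h, r, hr, rfl, hray⟩ := exists_rayPt_eq hP hwP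
    have hopen : IsOpen {q | famR p (rayPt x y h q) < s * famR p jPt} :=
      isOpen_lt (continuous_famR_rayPt p h) continuous_const
    obtain ⟨ε, hε, hball⟩ := Metric.isOpen_iff.mp hopen r hlt
    have hq : r + ε / 2 ∈ Metric.ball r ε := by
      rw [Metric.mem_ball, Real.dist_eq, add_sub_cancel_left, abs_of_pos (by positivity)]
      linarith
    have h1 := hmax _ (hray (r + ε / 2)) (le_of_lt (hball hq))
    rw [coshToJ_rayPt, ← Real.cosh_arcosh (one_le_coshToJ z), ← hdist_jPt, ← hwd, hdist_rayPt h hr,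
      Real.cosh_le_cosh, abs_of_nonneg (by positivity), abs_of_nonneg hr] at h1
    linarith

end Epsilon

/-! ### The ℓ¹ norm, submultiplicative and dominating the size. -/

section LOneNorm

/-- The sum of the absolute values of the coefficients. -/
def l1 (F : FormPoly ℤ) : ℝ := ∑ e ∈ F.support, |((F.coeff e : ℤ) : ℝ)|

theorem l1_eq_sum {F : FormPoly ℤ} {s : Finset (Fin 2 →₀ ℕ)} (h : F.support ⊆ s) :
    l1 F = ∑ e ∈ s, |((F.coeff e : ℤ) : ℝ)| := by
  apply Finset.sum_subset h
  intro e _ he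
  rw [notMem_support_iff.mp he]
  simp

theorem l1_nonneg (F : FormPoly ℤ) : 0 ≤ l1 F := Finset.sum_nonneg fun _ _ => abs_nonneg _

theorem l1_zero : l1 0 = 0 := by simp [l1]

theorem l1_add_le (F G : FormPoly ℤ) : l1 (F + G) ≤ l1 F + l1 G := by
  classical
  rw [l1_eq_sum (support_add (p := F) (q := G)), l1_eq_sum (F := F) Finset.subset_union_left,
    l1_eq_sum (F := G) Finset.subset_union_right, ← Finset.sum_add_distrib]
  apply Finset.sum_le_sum
  intro e _
  rw [coeff_add, Int.cast_add]
  exact abs_add_le _ _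

theorem l1_neg (F : FormPoly ℤ) : l1 (-F) = l1 F := by
  simp [l1]

theorem l1_sub_le (F G : FormPoly ℤ) : l1 (F - G) ≤ l1 F + l1 G := by
  rw [sub_eq_add_neg, ← l1_neg G]
  exact l1_add_le _ _

theorem l1_sum_le {ι : Type*} (s : Finset ι) (f : ι → FormPoly ℤ) :
    l1 (∑ i ∈ s, f i) ≤ ∑ i ∈ s, l1 (f i) := by
  classical
  induction s using Finset.induction_on with
  | empty => simp [l1_zero]
  | insert a s ha ih =>
    rw [Finset.sum_insert ha, Finset.sum_insert ha]
    exact (l1_add_le _ _).trans (by linarith)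

theorem l1_monomial (e : Fin 2 →₀ ℕ) (c : ℤ) : l1 (monomial e c) = |(c : ℝ)| := by
  classical
  rw [l1_eq_sum support_monomial_subset, Finset.sum_singleton, coeff_monomial, if_pos rfl]

theorem l1_mul_le (F G : FormPoly ℤ) : l1 (F * G) ≤ l1 F * l1 G := by
  have h : F * G = ∑ e ∈ F.support, ∑ e' ∈ G.support,
      monomial (e + e') (F.coeff e * G.coeff e') := by
    conv_lhs => rw [F.as_sum, G.as_sum]
    simp only [Finset.sum_mul_sum, monomial_mul]
  rw [h, l1.eq_def F, l1.eq_def G, Finset.sum_mul_sum]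
  refine (l1_sum_le _ _).trans (Finset.sum_le_sum fun e _ => ?_)
  refine (l1_sum_le _ _).trans (Finset.sum_le_sum fun e' _ => ?_)
  rw [l1_monomial, Int.cast_mul, abs_mul]

theorem l1_one : l1 1 = 1 := by
  rw [← C_1, C_apply, l1_monomial]
  simp

theorem l1_X (i : Fin 2) : l1 (X i) = 1 := by
  rw [X, l1_monomial]
  simp

theorem l1_prod_le {ι : Type*} (s : Finset ι) (f : ι → FormPoly ℤ) :
    l1 (∏ i ∈ s, f i) ≤ ∏ i ∈ s, l1 (f i) := by
  classical
  induction s using Finset.induction_on with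
  | empty => simp [l1_one]
  | insert a s ha ih =>
    rw [Finset.prod_insert ha, Finset.prod_insert ha]
    exact (l1_mul_le _ _).trans (mul_le_mul_of_nonneg_left ih (l1_nonneg _))

theorem l1_pow_le (F : FormPoly ℤ) (k : ℕ) : l1 (F ^ k) ≤ l1 F ^ k := by
  simpa using l1_prod_le (Finset.range k) fun _ => F

theorem l1_bind₁_le {F : FormPoly ℤ} {d : ℕ} (hF : F.IsHomogeneous d) {g : Fin 2 → FormPoly ℤ}
    {B : ℝ} (hg : ∀ i, l1 (g i) ≤ B) : l1 (bind₁ g F) ≤ l1 F * B ^ d := by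
  have h : bind₁ g F = ∑ e ∈ F.support, C (F.coeff e) * ∏ i, g i ^ e i := by
    rw [bind₁, aeval_def, eval₂_eq']
    rfl
  rw [h, l1.eq_def F, Finset.sum_mul]
  refine (l1_sum_le _ _).trans (Finset.sum_le_sum fun e he => ?_)
  have hB : 0 ≤ B := (l1_nonneg _).trans (hg 0)
  have hdeg : e 0 + e 1 = d := by
    by_contra hne
    apply mem_support_iff.mp he
    apply hF.coeff_eq_zero
    rwa [Finsupp.degree_eq_sum, Fin.sum_univ_two]
  refine (l1_mul_le _ _).trans ?_
  rw [C_apply, l1_monomial]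
  apply mul_le_mul_of_nonneg_left _ (abs_nonneg _)
  refine (l1_prod_le _ _).trans ?_
  rw [Fin.prod_univ_two, ← hdeg, pow_add]
  have hi : ∀ i, l1 (g i ^ e i) ≤ B ^ e i := fun i =>
    (l1_pow_le _ _).trans (pow_le_pow_left₀ (l1_nonneg _) (hg i) _)
  exact mul_le_mul (hi 0) (hi 1) (l1_nonneg _) (by positivity)

theorem size_toC (F : FormPoly ℤ) : size (toC F) = ∑ e ∈ F.support, |((F.coeff e : ℤ) : ℝ)| ^ 2 := by
  rw [size_eq_sum (F := toC F) (s := F.support) (support_map_subset _ _)]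
  apply Finset.sum_congr rfl
  intro e _
  rw [toC, coeff_map, eq_intCast, Complex.norm_intCast]

theorem size_toC_le (F : FormPoly ℤ) : size (toC F) ≤ l1 F ^ 2 := by
  rw [size_toC]
  exact Finset.sum_sq_le_sq_sum_of_nonneg fun _ _ => abs_nonneg _

end LOneNorm

/-! ### Polynomial bounds in the height for iterates and period forms. -/

section HeightBounds

variable {d : ℕ}

theorem IsModel.height_eq {f : Fin 2 → FormPoly ℤ} (hf : IsModel d f) :
    height d f = ((⨆ i, |coeffVec d f i| : ℤ) : ℝ) :=
  Rat.mulHeight_eq_max_abs_of_gcd_eq_one hf.coprime_coeffs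

theorem IsModel.abs_coeffVec_le {f : Fin 2 → FormPoly ℤ} (hf : IsModel d f)
    (i : Fin 2 × Fin (d + 1)) : |(coeffVec d f i : ℝ)| ≤ height d f := by
  rw [hf.height_eq]
  have : |coeffVec d f i| ≤ ⨆ i, |coeffVec d f i| :=
    Finite.le_ciSup (fun i => |coeffVec d f i|) i
  exact_mod_cast this

theorem one_le_height (d : ℕ) (f : Fin 2 → FormPoly ℤ) : 1 ≤ height d f :=
  Height.one_le_mulHeight _

theorem IsModel.l1_le {f : Fin 2 → FormPoly ℤ} (hf : IsModel d f) (i : Fin 2) :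
    l1 (f i) ≤ (d + 1) * height d f := by
  classical
  set mon : Fin (d + 1) → Fin 2 →₀ ℕ := fun j =>
    Finsupp.single 0 (d - (j : ℕ)) + Finsupp.single 1 (j : ℕ) with hmon
  have hs : (f i).support ⊆ Finset.univ.image mon := by
    intro e he
    have hdeg : e 0 + e 1 = d := by
      by_contra hne
      apply mem_support_iff.mp he
      apply (hf.homogeneous i).coeff_eq_zero
      rwa [Finsupp.degree_eq_sum, Fin.sum_univ_two]
    rw [Finset.mem_image]
    refine ⟨⟨e 1, by omega⟩, Finset.mem_univ _, ?_⟩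
    ext j
    fin_cases j
    · simp [hmon]
      omega
    · simp [hmon]
  have hH : 0 ≤ height d f := zero_le_one.trans (one_le_height d f)
  rw [l1_eq_sum hs]
  have hcard : ((Finset.univ.image mon).card : ℝ) ≤ d + 1 := by
    have := Finset.card_image_le (s := Finset.univ) (f := mon)
    rw [Finset.card_univ, Fintype.card_fin] at this
    exact_mod_cast this
  calc ∑ e ∈ Finset.univ.image mon, |(((f i).coeff e : ℤ) : ℝ)|
      ≤ (Finset.univ.image mon).card • height d f := by
        apply Finset.sum_le_card_nsmul
        intro e he
        obtain ⟨j, -, rfl⟩ := Finset.mem_image.mp he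
        exact hf.abs_coeffVec_le (i, j)
    _ ≤ _ := by
      rw [nsmul_eq_mul]
      exact mul_le_mul_of_nonneg_right hcard hH

/-- `g f` is bounded by a constant multiple of a power of `H(f)` for endomorphisms `f` of
degree `d`. -/
def PolyBdd (d : ℕ) (g : (Fin 2 → FormPoly ℤ) → ℝ) : Prop :=
  ∃ (C : ℝ) (k : ℕ), 0 < C ∧ ∀ f, IsModel d f → g f ≤ C * height d f ^ k

theorem PolyBdd.mono {g g' : (Fin 2 → FormPoly ℤ) → ℝ} (h : PolyBdd d g)
    (hle : ∀ f, IsModel d f → g' f ≤ g f) : PolyBdd d g' := by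
  obtain ⟨C, k, hC, h⟩ := h
  exact ⟨C, k, hC, fun f hf => (hle f hf).trans (h f hf)⟩

theorem polyBdd_const (c : ℝ) : PolyBdd d fun _ => c :=
  ⟨|c| + 1, 0, by positivity, fun f _ => by
    rw [pow_zero, mul_one]
    linarith [le_abs_self c]⟩

theorem PolyBdd.mul {g g' : (Fin 2 → FormPoly ℤ) → ℝ} (h : PolyBdd d g) (h' : PolyBdd d g')
    (hg' : ∀ f, 0 ≤ g' f) : PolyBdd d fun f => g f * g' f := by
  obtain ⟨C, k, hC, h⟩ := h
  obtain ⟨C', k', hC', h'⟩ := h'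
  refine ⟨C * C', k + k', by positivity, fun f hf => ?_⟩
  have hH : 0 ≤ height d f := zero_le_one.trans (one_le_height d f)
  calc g f * g' f ≤ (C * height d f ^ k) * (C' * height d f ^ k') :=
        mul_le_mul (h f hf) (h' f hf) (hg' f) (by positivity)
    _ = _ := by rw [pow_add]; ring

theorem PolyBdd.pow {g : (Fin 2 → FormPoly ℤ) → ℝ} (h : PolyBdd d g) (hg : ∀ f, 0 ≤ g f) (n : ℕ) :
    PolyBdd d fun f => g f ^ n := by
  induction n with
  | zero => simpa using polyBdd_const 1
  | succ n ih =>
    simp only [pow_succ]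
    exact ih.mul h hg

theorem PolyBdd.prod {ι : Type*} (s : Finset ι) {g : ι → (Fin 2 → FormPoly ℤ) → ℝ}
    (h : ∀ i, PolyBdd d (g i)) (hg : ∀ i f, 0 ≤ g i f) : PolyBdd d fun f => ∏ i ∈ s, g i f := by
  classical
  induction s using Finset.induction_on with
  | empty => simpa using polyBdd_const 1
  | insert a s ha ih =>
    simp only [Finset.prod_insert ha]
    exact (h a).mul ih fun f => Finset.prod_nonneg fun i _ => hg i f

theorem polyBdd_l1_iter (m : ℕ) : ∃ B : (Fin 2 → FormPoly ℤ) → ℝ, PolyBdd d B ∧ (∀ f, 0 ≤ B f) ∧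
    ∀ f, IsModel d f → ∀ i, l1 (iter f m i) ≤ B f := by
  induction m with
  | zero =>
    exact ⟨fun _ => 1, polyBdd_const 1, fun _ => zero_le_one, fun f _ i => (l1_X i).le⟩
  | succ m ih =>
    obtain ⟨B, hB, hB0, hle⟩ := ih
    have hH : ∀ f, 0 ≤ height d f := fun f => zero_le_one.trans (one_le_height d f)
    refine ⟨fun f => (d + 1) * height d f * B f ^ d, ?_, ?_, ?_⟩
    · refine PolyBdd.mul ⟨d + 1, 1, by positivity, fun f _ => by rw [pow_one]⟩
        (hB.pow hB0 d) fun f => pow_nonneg (hB0 f) d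
    · intro f
      have := hH f
      have := hB0 f
      positivity
    · intro f hf i
      exact (l1_bind₁_le (hf.homogeneous i) (hle f hf)).trans
        (mul_le_mul_of_nonneg_right (hf.l1_le i) (pow_nonneg (hB0 f) d))

theorem polyBdd_l1_periodForm (m : ℕ) : PolyBdd d fun f => l1 (periodForm m f) := by
  obtain ⟨B, hB, hB0, hle⟩ := polyBdd_l1_iter (d := d) m
  refine ((polyBdd_const (d := d) 2).mul hB hB0).mono fun f hf => ?_
  have h : ∀ i j, l1 (X i * iter f m j) ≤ B f := fun i j =>
    (l1_mul_le _ _).trans (by rw [l1_X, one_mul]; exact hle f hf j)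
  exact (l1_sub_le _ _).trans (by linarith [h 1 0, h 0 1])

theorem IsModel.totalDegree_periodForm_le {f : Fin 2 → FormPoly ℤ} (hf : IsModel d f) (m : ℕ) :
    (periodForm m f).totalDegree ≤ 1 + d ^ m :=
  (((isHomogeneous_X ℤ 1).mul (hf.iter_isHomogeneous m 0)).sub
    ((isHomogeneous_X ℤ 0).mul (hf.iter_isHomogeneous m 1))).totalDegree_le

end HeightBounds

/-! ### Coefficient bounds for factors, and part (i). -/

section Factors

/-- The Kronecker substitution `x ↦ X`, `y ↦ X ^ N`. -/
def kronecker (N : ℕ) : FormPoly ℤ →ₐ[ℤ] Polynomial ℤ := aeval ![Polynomial.X, Polynomial.X ^ N]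

theorem kronecker_eq_sum (N : ℕ) (F : FormPoly ℤ) :
    kronecker N F = ∑ e ∈ F.support, Polynomial.monomial (e 0 + N * e 1) (F.coeff e) := by
  conv_lhs => rw [F.as_sum, map_sum]
  apply Finset.sum_congr rfl
  intro e _
  rw [kronecker, aeval_monomial, Finsupp.prod_fintype _ _ (by simp), Fin.prod_univ_two]
  simp only [Matrix.cons_val_zero, Matrix.cons_val_one, ← pow_mul, ← pow_add]
  rw [← Polynomial.C_mul_X_pow_eq_monomial]
  rfl

theorem le_totalDegree_of_mem {F : FormPoly ℤ} {e : Fin 2 →₀ ℕ} (he : e ∈ F.support) :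
    e 0 + e 1 ≤ F.totalDegree := by
  have := le_totalDegree he
  rwa [Finsupp.sum_fintype _ _ (by simp), Fin.sum_univ_two] at this

theorem kronecker_injOn {N : ℕ} {e e' : Fin 2 →₀ ℕ} (he : e 0 < N) (he' : e' 0 < N)
    (h : e 0 + N * e 1 = e' 0 + N * e' 1) : e = e' := by
  have h0 : e 0 = e' 0 := by
    have := congrArg (· % N) h
    simpa [Nat.add_mul_mod_self_left, Nat.mod_eq_of_lt he, Nat.mod_eq_of_lt he'] using this
  have h1 : e 1 = e' 1 := by
    rw [h0] at h
    exact Nat.eq_of_mul_eq_mul_left (by omega) (Nat.add_left_cancel h)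
  ext i
  fin_cases i
  · exact h0
  · exact h1

theorem coeff_kronecker {N : ℕ} {F : FormPoly ℤ} (hF : F.totalDegree < N) {e : Fin 2 →₀ ℕ}
    (he : e ∈ F.support) : (kronecker N F).coeff (e 0 + N * e 1) = F.coeff e := by
  rw [kronecker_eq_sum, Polynomial.finsetSum_coeff, Finset.sum_eq_single e]
  · simp
  · intro e' he' hne
    rw [Polynomial.coeff_monomial, if_neg]
    intro h
    have := le_totalDegree_of_mem he
    have := le_totalDegree_of_mem he'
    exact hne (kronecker_injOn (by omega) (by omega) h)
  · intro h
    exact absurd he h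

theorem kronecker_ne_zero {N : ℕ} {F : FormPoly ℤ} (hF : F.totalDegree < N) (h0 : F ≠ 0) :
    kronecker N F ≠ 0 := by
  obtain ⟨e, he⟩ := support_nonempty.mpr h0
  intro h
  have := coeff_kronecker hF he
  rw [h, Polynomial.coeff_zero] at this
  exact mem_support_iff.mp he this.symm

theorem natDegree_kronecker_le {N : ℕ} {F : FormPoly ℤ} (hF : F.totalDegree < N) :
    (kronecker N F).natDegree ≤ N * N := by
  rw [kronecker_eq_sum]
  apply Polynomial.natDegree_sum_le_of_forall_le
  intro e he
  have := le_totalDegree_of_mem he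
  refine (Polynomial.natDegree_monomial_le _).trans ?_
  have h1 : e 0 + e 1 ≤ N := by omega
  have h2 : 1 ≤ N := by omega
  nlinarith

theorem mahlerMeasure_kronecker_le (N : ℕ) (F : FormPoly ℤ) :
    ((kronecker N F).map (Int.castRingHom ℂ)).mahlerMeasure ≤ l1 F := by
  classical
  refine (Polynomial.mahlerMeasure_le_sum_norm_coeff _).trans ?_
  set q := (kronecker N F).map (Int.castRingHom ℂ) with hq
  have hcoeff : ∀ i, ‖q.coeff i‖ ≤ ∑ e ∈ F.support,
      if e 0 + N * e 1 = i then |((F.coeff e : ℤ) : ℝ)| else 0 := by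
    intro i
    rw [hq, Polynomial.coeff_map, eq_intCast, Complex.norm_intCast, kronecker_eq_sum,
      Polynomial.finsetSum_coeff, Int.cast_sum]
    refine (Finset.abs_sum_le_sum_abs _ _).trans (Finset.sum_le_sum fun e _ => ?_)
    rw [Polynomial.coeff_monomial]
    split_ifs <;> simp
  rw [Polynomial.sum_def]
  refine (Finset.sum_le_sum fun i _ => hcoeff i).trans ?_
  rw [Finset.sum_comm, l1]
  apply Finset.sum_le_sum
  intro e _
  rw [Finset.sum_ite_eq]
  split_ifs
  · exact le_rfl
  · exact abs_nonneg _

/-- Mahler measure is multiplicative and at least `1` on nonzero integral polynomials, so the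
cofactor `B` can be dropped; coefficients are at most binomials times the measure. The Kronecker
substitution, injective on monomials of degree below `N`, reduces this to one variable. -/
theorem size_toC_le_of_mul_eq {Φ A B : FormPoly ℤ} {N : ℕ} (h : Φ * B = A) (hΦ : Φ.totalDegree < N)
    (hB : B.totalDegree < N) (hB0 : B ≠ 0) :
    size (toC Φ) ≤ (N * N + 1) * (2 ^ (N * N) * l1 A) ^ 2 := by
  classical
  set q := (kronecker N Φ).map (Int.castRingHom ℂ) with hq
  have hM : q.mahlerMeasure ≤ l1 A := by
    refine le_trans ?_ (mahlerMeasure_kronecker_le N A)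
    rw [← h, map_mul, Polynomial.map_mul, Polynomial.mahlerMeasure_mul]
    exact le_mul_of_one_le_right (Polynomial.mahlerMeasure_nonneg _)
      (Polynomial.one_le_mahlerMeasure_of_ne_zero (kronecker_ne_zero hB hB0))
  have hdeg : q.natDegree ≤ N * N :=
    Polynomial.natDegree_map_le.trans (natDegree_kronecker_le hΦ)
  have hcoeff : ∀ e ∈ Φ.support, |((Φ.coeff e : ℤ) : ℝ)| ^ 2 ≤ (2 ^ (N * N) * l1 A) ^ 2 := by
    intro e he
    apply pow_le_pow_left₀ (abs_nonneg _)
    have h1 := Polynomial.norm_coeff_le_choose_mul_mahlerMeasure (e 0 + N * e 1) q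
    rw [hq, Polynomial.coeff_map, eq_intCast, Complex.norm_intCast, coeff_kronecker hΦ he,
      ← hq] at h1
    refine h1.trans (mul_le_mul ?_ hM (Polynomial.mahlerMeasure_nonneg _) (by positivity))
    have h2 : q.natDegree.choose (e 0 + N * e 1) ≤ 2 ^ (N * N) :=
      (Nat.choose_le_two_pow _ _).trans (Nat.pow_le_pow_right two_pos hdeg)
    exact_mod_cast h2
  have hcard : Φ.support.card ≤ N * N + 1 := by
    rw [← Finset.card_range (N * N + 1)]
    apply Finset.card_le_card_of_injOn fun e => e 0 + N * e 1
    · intro e he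
      have := le_totalDegree_of_mem he
      have h1 : e 0 + e 1 ≤ N := by omega
      have h2 : 1 ≤ N := by omega
      simp only [Finset.coe_range, Set.mem_Iio]
      nlinarith
    · intro e he e' he' hee
      have := le_totalDegree_of_mem he
      have := le_totalDegree_of_mem he'
      exact kronecker_injOn (by omega) (by omega) hee
  rw [size_toC]
  refine (Finset.sum_le_card_nsmul _ _ _ hcoeff).trans ?_
  rw [nsmul_eq_mul]
  apply mul_le_mul_of_nonneg_right _ (by positivity)
  exact_mod_cast hcard

/-- The product of the period forms whose exponent in the dynatomic form is `ε`. -/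
def moebiusPart (m : ℕ) (ε : ℤ) (f : Fin 2 → FormPoly ℤ) : FormPoly ℤ :=
  ∏ k ∈ m.divisors, if ArithmeticFunction.moebius (m / k) = ε then periodForm k f else 1

theorem IsDynatomic.mul_eq {m : ℕ} {f : Fin 2 → FormPoly ℤ} {Φ : FormPoly ℤ}
    (h : IsDynatomic m f Φ) (hΦ : Φ ≠ 0) :
    Φ * moebiusPart m (-1) f = moebiusPart m 1 f ∧ moebiusPart m (-1) f ≠ 0 := by
  have hinj : Function.Injective (algebraMap (FormPoly ℤ) (FractionRing (FormPoly ℤ))) := IsFractionRing.injective _ _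
  -- Since `0⁻¹ = 0`, a vanishing period form with exponent `1` or `-1` would make `Φ` zero.
  have hne : ∀ k ∈ m.divisors, ArithmeticFunction.moebius (m / k) ≠ 0 → periodForm k f ≠ 0 := by
    intro k hk hμ h0
    have h1 : algebraMap (FormPoly ℤ) (FractionRing (FormPoly ℤ)) Φ = 0 := by
      rw [h]
      apply Finset.prod_eq_zero hk
      rw [h0, map_zero, zero_zpow _ hμ]
    exact hΦ (hinj (by rw [h1, map_zero]))
  constructor
  · apply hinj
    rw [map_mul, h, moebiusPart, moebiusPart, map_prod, map_prod, ← Finset.prod_mul_distrib]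
    apply Finset.prod_congr rfl
    intro k hk
    rcases ArithmeticFunction.moebius_eq_or (m / k) with h0 | h0 | h0
    · simp [h0]
    · simp [h0]
    · have h1 : algebraMap (FormPoly ℤ) (FractionRing (FormPoly ℤ)) (periodForm k f) ≠ 0 := by
        rw [Ne, map_eq_zero_iff _ hinj]
        exact hne k hk (by rw [h0]; decide)
      simp [h0, h1]
  · rw [moebiusPart, Finset.prod_ne_zero_iff]
    intro k hk
    split_ifs with h1
    · exact hne k hk (by rw [h1]; decide)
    · exact one_ne_zero

theorem IsModel.totalDegree_moebiusPart_le {d : ℕ} {f : Fin 2 → FormPoly ℤ} (hf : IsModel d f)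
    (m : ℕ) (ε : ℤ) : (moebiusPart m ε f).totalDegree ≤ ∑ k ∈ m.divisors, (1 + d ^ k) := by
  refine (totalDegree_finsetProd _ _).trans (Finset.sum_le_sum fun k _ => ?_)
  split_ifs
  · exact hf.totalDegree_periodForm_le k
  · simp

theorem polyBdd_l1_moebiusPart (d m : ℕ) (ε : ℤ) : PolyBdd d fun f => l1 (moebiusPart m ε f) := by
  refine (PolyBdd.prod m.divisors (g := fun k f => l1 (if ArithmeticFunction.moebius (m / k) = ε
    then periodForm k f else 1)) (fun k => ?_) fun k f => l1_nonneg _).mono fun f _ => l1_prod_le _ _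
  split_ifs
  · exact polyBdd_l1_periodForm k
  · exact polyBdd_const _

theorem polyBdd_size_periodForm (d m : ℕ) : PolyBdd d fun f => size (toC (periodForm m f)) :=
  ((polyBdd_l1_periodForm m).pow (fun _ => l1_nonneg _) 2).mono fun _ _ => size_toC_le _

theorem polyBdd_size_dynatomicForm (d m : ℕ) :
    PolyBdd d fun f => size (toC (dynatomicForm m f)) := by
  set N := ∑ k ∈ m.divisors, (1 + d ^ k) + 1 with hN
  refine ((polyBdd_const ((N * N + 1) * (2 ^ (N * N)) ^ 2 : ℝ)).mul
    ((polyBdd_l1_moebiusPart d m 1).pow (fun _ => l1_nonneg _) 2)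
    fun f => by positivity).mono fun f hf => ?_
  by_cases h0 : dynatomicForm m f = 0
  · have : size (toC (0 : FormPoly ℤ)) = 0 := by simp [size, toC]
    rw [h0, this]
    positivity
  · obtain ⟨h1, h2⟩ := (isDynatomic_of_ne_zero h0).mul_eq h0
    have hA := hf.totalDegree_moebiusPart_le m 1
    have hB := hf.totalDegree_moebiusPart_le m (-1)
    have hΦ : (dynatomicForm m f).totalDegree ≤ (moebiusPart m 1 f).totalDegree := by
      rw [← h1, totalDegree_mul_of_isDomain h0 h2]
      exact Nat.le_add_right _ _
    have := size_toC_le_of_mul_eq (N := N) h1 (by omega) (by omega) h2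
    rw [mul_pow, ← mul_assoc] at this
    exact this

theorem exists_isSizeBound {d : ℕ} {Φ : (Fin 2 → FormPoly ℤ) → FormPoly ℤ}
    (h : PolyBdd d fun f => size (toC (Φ f))) : ∃ C k : ℝ, IsSizeBound d Φ C k := by
  obtain ⟨C, k, hC, h⟩ := h
  -- The exponent must be positive and `k` may be `0`; raising it is harmless since `H(f) ≥ 1`.
  refine ⟨C, (k + 1 : ℕ), hC, by positivity, fun f hf => (h f hf).trans ?_⟩
  rw [Real.rpow_natCast]
  exact mul_le_mul_of_nonneg_left (pow_le_pow_right₀ (one_le_height d f) (Nat.le_succ k)) hC.le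

end Factors

/-! ### The covariant point of a stable form, and the search region. -/

section StableForms

theorem IsStable.exists_stableFam {F : FormPoly ℂ} (hF : IsStable F) :
    ∃ p : Fin F.totalDegree → ℂ × ℂ, StableFam p ∧ F = ∏ k, lin (p k) := by
  obtain ⟨p, hp, h⟩ := exists_prod_lin hF.totalDegree_ne_zero hF.1 hF.ne_zero
  exact ⟨p, stableFam_of_isStable hp (h ▸ hF), h⟩

theorem StableFam.bigR_eq {n : ℕ} {p : Fin n → ℂ × ℂ} (hp : StableFam p) {F : FormPoly ℂ}
    (h : F = ∏ k, lin (p k)) (z : HSpace) : bigR F z = famR p z := by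
  rw [h, bigR_prod_lin hp.1, famR]

theorem IsStable.zPt_minimizer {F : FormPoly ℂ} (hF : IsStable F) (w : HSpace) :
    bigR F (zPt F) ≤ bigR F w := by
  obtain ⟨p, hp, h⟩ := hF.exists_stableFam
  have hex : ∃ z, ∀ w, bigR F z ≤ bigR F w := by
    simpa only [hp.bigR_eq h] using hp.exists_minimizer
  rw [zPt, dif_pos hex]
  exact hex.choose_spec w

/-- Complex conjugation on hyperbolic three-space. -/
def conjPt (z : HSpace) : HSpace := ⟨star z.t, z.u, z.u_pos⟩

theorem wt_star (z : HSpace) (v : ℂ × ℂ) : wt z (star v.1, star v.2) = wt (conjPt z) v := by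
  simp only [wt, conjPt, norm_star]
  rw [← norm_star (v.1 - v.2 * star z.t)]
  simp

theorem map_conj_lin (v : ℂ × ℂ) :
    map (starRingEnd ℂ) (lin v) = lin (star v.1, star v.2) := by
  simp [lin]

theorem map_conj_toC (G : FormPoly ℤ) : map (starRingEnd ℂ) (toC G) = toC G := by
  rw [toC, map_map]
  exact congrArg (fun φ : ℤ →+* ℂ => map φ G) (RingHom.ext_int _ _)

/-- `R` of a real form is invariant under complex conjugation, so the unique minimizer is fixed by
it. -/
theorem zPt_mem_realPlane {G : FormPoly ℤ} (hG : IsStable (toC G)) : zPt (toC G) ∈ realPlane := by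
  obtain ⟨p, hp, h⟩ := hG.exists_stableFam
  have h' : toC G = ∏ k, lin (star (p k).1, star (p k).2) := by
    refine (map_conj_toC G).symm.trans ((congrArg (map (starRingEnd ℂ)) h).trans ?_)
    rw [map_prod]
    simp only [map_conj_lin]
  have hp' : ∀ k, (star (p k).1, star (p k).2) ≠ (0 : ℂ × ℂ) := by
    intro k hk
    rw [Prod.mk_eq_zero, star_eq_zero, star_eq_zero] at hk
    exact hp.1 k (Prod.ext hk.1 hk.2)
  have hconj : ∀ z, famR p (conjPt z) = famR p z := by
    intro z
    rw [← hp.bigR_eq h z]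
    conv_rhs => rw [h']
    rw [bigR_prod_lin hp']
    simp only [wt_star, famR]
  have hmin : ∀ w, famR p (zPt (toC G)) ≤ famR p w := by
    simpa only [hp.bigR_eq h] using hG.zPt_minimizer
  have heq := hp.minimizer_unique hmin (w := conjPt (zPt (toC G))) (by
    intro w
    rw [hconj]
    exact hmin w)
  have ht : star (zPt (toC G)).t = (zPt (toC G)).t := congrArg HSpace.t heq
  exact Complex.conj_eq_iff_im.mp ht

theorem vact_vact (v : ℂ × ℂ) (M N : SL(2, ℂ)) : vact (vact v M) N = vact v (M * N) := by
  simp only [vact, Matrix.SpecialLinearGroup.coe_mul, Matrix.mul_apply, Fin.sum_univ_two]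
  ext <;> ring

theorem moeb_jPt_mem_realPlane {M : SL(2, ℂ)} (hM : ∀ i j, (M i j).im = 0) :
    moeb M jPt ∈ realPlane := by
  change (moeb M jPt).t.im = 0
  simp only [moeb]
  rw [Complex.div_ofReal_im]
  simp [jPt, hM]

theorem inv_toPt_mul_im {z : HSpace} (hz : z ∈ realPlane) (γ : SL(2, ℤ)) (i j : Fin 2) :
    (((toPt z)⁻¹ * intSL γ) i j).im = 0 := by
  have hz' : z.t.im = 0 := hz
  have h1 : ∀ i j, ((toPt z)⁻¹ i j).im = 0 := by
    intro i j
    fin_cases i <;> fin_cases j <;>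
      simp [Matrix.SpecialLinearGroup.SL2_inv_expl, toPt_00, toPt_01, toPt_10, toPt_11, hz',
        ← Complex.ofReal_inv, Complex.div_ofReal_im]
  have h2 : ∀ i j, (intSL γ i j).im = 0 := by
    intro i j
    simp [intSL]
  rw [Matrix.SpecialLinearGroup.coe_mul, Matrix.mul_apply, Fin.sum_univ_two]
  simp only [Complex.add_im, Complex.mul_im, h1, h2, mul_zero, zero_mul, add_zero]

theorem eps_eq_epsFam {n : ℕ} {p : Fin n → ℂ × ℂ} (hp : StableFam p) {F : FormPoly ℂ}
    (h : F = ∏ k, lin (p k)) (P : Set HSpace) :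
    eps P F = epsFam P fun k => vact (p k) (toPt (zPt F)) := by
  funext δ
  have h' : subst F (toPt (zPt F)) = ∏ k, lin (vact (p k) (toPt (zPt F))) := by
    rw [subst_eq_substHom]
    conv_lhs => rw [h]
    rw [substHom_prod_lin, ← h]
  simp only [eps, epsNormalized, epsFam, (hp.vact _).bigR_eq h']

theorem lt_bigR_of_searchBound_lt {F : FormPoly ℂ} (hF : IsStable F) {P : Set HSpace}
    (hP : P = Set.univ ∨ P = realPlane) (hreal : zPt F ∈ realPlane) {s : ℝ}
    (hs : 1 ≤ 2 ^ (F.totalDegree - 1) * (s / theta F)) {γ : SL(2, ℤ)}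
    (hγ : searchBound P F s < coshToJ (moeb (intSL γ)⁻¹ (zPt F))) :
    2 ^ (F.totalDegree - 1) * s < bigR (substHom (intSL γ) F) jPt := by
  obtain ⟨p, hp, h⟩ := hF.exists_stableFam
  set z := zPt F with hz
  set A := toPt z with hA
  set q := fun k => vact (p k) A with hq
  have hqs : StableFam q := hp.vact A
  set σ := 2 ^ (F.totalDegree - 1) * (s / theta F) with hσ
  have heps : eps P F = epsFam P q := eps_eq_epsFam hp h P
  -- `epsInv` is a true right inverse only at attained values; `σ ≥ 1` ensures this.
  obtain ⟨δ₀, hδ₀, hδ₀'⟩ := hqs.exists_epsFam_eq hP hs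
  have hex : ∃ a ∈ Set.Ici (0 : ℝ), eps P F a = σ := ⟨δ₀, hδ₀, by rw [heps, hδ₀']⟩
  have hδ : 0 ≤ epsInv P F σ := Function.invFunOn_mem hex
  have hδ' : epsFam P q (epsInv P F σ) = σ := by
    rw [← heps]
    exact Function.invFunOn_eq hex
  have hθ : theta F = famR p z := hp.bigR_eq h z
  have hqj : famR q jPt = theta F := by
    rw [hθ, hq, famR_vact, hA, moeb_toPt_jPt]
  have hmin : ∀ w, famR q jPt ≤ famR q w := by
    intro w
    rw [hqj, theta, hq, famR_vact, ← hp.bigR_eq h]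
    exact hF.zPt_minimizer _
  -- As `F · γ = (F · A) · N`, the value `R(F · γ, j)` is that of the normalized form at `N j`.
  -- Since `N⁻¹ = γ⁻¹ A` maps `j` to `γ⁻¹ z`, the point `N j` is as far from `j` as `γ⁻¹ z`.
  set N := A⁻¹ * intSL γ with hN
  have hcosh : coshToJ (moeb N jPt) = coshToJ (moeb (intSL γ)⁻¹ z) := by
    rw [← coshToJ_moeb_inv_jPt, hN, mul_inv_rev, inv_inv, coshToJ_moeb_eq (intSL γ)⁻¹ z]
  have hmem : moeb N jPt ∈ P := by
    rcases hP with rfl | rfl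
    · trivial
    · exact moeb_jPt_mem_realPlane (inv_toPt_mul_im hreal γ)
  have key := hqs.epsFam_lt hP hmin hmem hδ (by
    rw [hcosh]
    exact hγ)
  have hbig : bigR (substHom (intSL γ) F) jPt = famR q (moeb N jPt) := by
    have h' : substHom (intSL γ) F = ∏ k, lin (vact (p k) (intSL γ)) := by
      conv_lhs => rw [h]
      rw [substHom_prod_lin]
    rw [(hp.vact _).bigR_eq h', ← famR_vact]
    simp only [hq, vact_vact, hN, mul_inv_cancel_left]
  have hθpos : 0 < theta F := by
    rw [hθ]
    exact famR_pos hp.1 z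
  rw [hδ', hqj, lt_div_iff₀ hθpos, ← hbig] at key
  refine lt_of_eq_of_lt ?_ key
  rw [hσ]
  field_simp

theorem finite_coshToJ_le (z : HSpace) (c : ℝ) :
    {γ : SL(2, ℤ) | coshToJ (moeb (intSL γ)⁻¹ z) ≤ c}.Finite := by
  have hu := z.u_pos
  set Q := 2 * c * z.u with hQ
  -- A row `(m, -n)` of `γ⁻¹`, up to sign, satisfies `|m t - n| ^ 2 + m ^ 2 u ^ 2 ≤ Q`; the two
  -- summands bound `m ^ 2` and `n ^ 2`.
  set B := Q / z.u ^ 2 + (2 * Q + 2 * (Q / z.u ^ 2) * ‖z.t‖ ^ 2) with hB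
  have hfin : {m : Fin 2 → Fin 2 → ℤ | ∀ i, m i ∈
      {r : Fin 2 → ℤ | ∀ j, r j ∈ Set.Icc (-⌈B⌉) ⌈B⌉}}.Finite :=
    Set.Finite.pi' fun _ => Set.Finite.pi' fun _ => Set.finite_Icc _ _
  have hinj : Function.Injective fun γ : SL(2, ℤ) => fun i j => γ i j := by
    intro γ δ h
    ext i j
    exact congrFun (congrFun h i) j
  refine (hfin.preimage hinj.injOn).subset ?_
  intro γ hγ
  have hγ' : coshToJ (moeb (intSL γ)⁻¹ z) ≤ c := hγ
  have e00 : (intSL γ)⁻¹ 0 0 = (γ 1 1 : ℂ) := by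
    simp [Matrix.SpecialLinearGroup.SL2_inv_expl, intSL]
  have e01 : (intSL γ)⁻¹ 0 1 = -(γ 0 1 : ℂ) := by
    simp [Matrix.SpecialLinearGroup.SL2_inv_expl, intSL]
  have e10 : (intSL γ)⁻¹ 1 0 = -(γ 1 0 : ℂ) := by
    simp [Matrix.SpecialLinearGroup.SL2_inv_expl, intSL]
  have e11 : (intSL γ)⁻¹ 1 1 = (γ 0 0 : ℂ) := by
    simp [Matrix.SpecialLinearGroup.SL2_inv_expl, intSL]
  rw [coshToJ_moeb, e00, e01, e10, e11, div_le_iff₀ (by positivity)] at hγ'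
  rw [show c * (2 * z.u) = Q by rw [hQ]; ring, norm_neg] at hγ'
  have key : ∀ (m n : ℤ), ‖(m : ℂ) * z.t - n‖ ^ 2 + ‖(m : ℂ)‖ ^ 2 * z.u ^ 2 ≤ Q →
      m ∈ Set.Icc (-⌈B⌉) ⌈B⌉ ∧ n ∈ Set.Icc (-⌈B⌉) ⌈B⌉ := by
    intro m n h
    have hQ0 : 0 ≤ Q := le_trans (by positivity) h
    have hm : ‖(m : ℂ)‖ ^ 2 ≤ Q / z.u ^ 2 := by
      rw [le_div_iff₀ (by positivity)]
      nlinarith [sq_nonneg ‖(m : ℂ) * z.t - n‖]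
    have hmn : ‖(m : ℂ) * z.t - n‖ ^ 2 ≤ Q := by
      have : 0 ≤ ‖(m : ℂ)‖ ^ 2 * z.u ^ 2 := by positivity
      linarith
    have hn : ‖(n : ℂ)‖ ^ 2 ≤ 2 * Q + 2 * (Q / z.u ^ 2) * ‖z.t‖ ^ 2 := by
      have h1 := norm_sq_sub_le ((m : ℂ) * z.t) ((m : ℂ) * z.t - n)
      rw [sub_sub_cancel, norm_mul, mul_pow] at h1
      nlinarith [mul_le_mul_of_nonneg_right hm (sq_nonneg ‖z.t‖)]
    have hsq : ∀ r : ℤ, ‖(r : ℂ)‖ ^ 2 ≤ B → r ∈ Set.Icc (-⌈B⌉) ⌈B⌉ := by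
      intro r hr
      rw [Complex.norm_intCast, sq_abs] at hr
      have h1 : r ^ 2 ≤ ⌈B⌉ := by
        have : ((r ^ 2 : ℤ) : ℝ) ≤ (⌈B⌉ : ℝ) := by
          push_cast
          exact hr.trans (Int.le_ceil B)
        exact_mod_cast this
      have h2 : r ≤ r ^ 2 := Int.le_self_sq r
      have h3 : -r ≤ (-r) ^ 2 := Int.le_self_sq (-r)
      rw [neg_sq] at h3
      constructor <;> linarith
    have hm0 : 0 ≤ Q / z.u ^ 2 := by positivity
    have hn0 : 0 ≤ 2 * Q + 2 * (Q / z.u ^ 2) * ‖z.t‖ ^ 2 := by positivity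
    exact ⟨hsq m (by rw [hB]; linarith), hsq n (by rw [hB]; linarith)⟩
  have hx : 0 ≤ ‖(γ 1 1 : ℂ) * z.t + -(γ 0 1 : ℂ)‖ ^ 2 + ‖(γ 1 1 : ℂ)‖ ^ 2 * z.u ^ 2 := by
    positivity
  have hy : 0 ≤ ‖-(γ 1 0 : ℂ) * z.t + (γ 0 0 : ℂ)‖ ^ 2 + ‖(γ 1 0 : ℂ)‖ ^ 2 * z.u ^ 2 := by
    positivity
  have k1 := key (γ 1 1) (γ 0 1) (by
    rw [sub_eq_add_neg]
    linarith)
  have k2 := key (γ 1 0) (γ 0 0) (by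
    rw [← norm_neg, show -((γ 1 0 : ℂ) * z.t - (γ 0 0 : ℂ)) = -(γ 1 0 : ℂ) * z.t + (γ 0 0 : ℂ) by
      ring]
    linarith)
  intro i j
  fin_cases i <;> fin_cases j
  · exact k2.2
  · exact k1.2
  · exact k2.1
  · exact k1.1

end StableForms

/-! ### Comparison of heights. -/

section Reduction

theorem conj_eq_substHom {m : ℕ} {Φ : (Fin 2 → FormPoly ℤ) → FormPoly ℤ}
    (hΦ : Φ = periodForm m ∨ Φ = dynatomicForm m) {f : Fin 2 → FormPoly ℤ} (h0 : Φ f ≠ 0)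
    (γ : SL(2, ℤ)) : Φ (conj f γ) = substHom γ (Φ f) := by
  rcases hΦ with rfl | rfl
  · exact periodForm_conj m f γ
  · exact dynatomicForm_conj h0 γ

theorem height_lt_height_conj {d m : ℕ} {Φ : (Fin 2 → FormPoly ℤ) → FormPoly ℤ}
    (hΦ : Φ = periodForm m ∨ Φ = dynatomicForm m) {C k : ℝ} (hCk : IsSizeBound d Φ C k)
    {P : Set HSpace} (hP : P = Set.univ ∨ P = realPlane) {f : Fin 2 → FormPoly ℤ}
    (hf : IsModel d f) (hst : IsStable (toC (Φ f))) {γ : SL(2, ℤ)}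
    (hγ : searchBound P (toC (Φ f)) (C * height d f ^ k) <
      coshToJ (moeb (intSL γ)⁻¹ (zPt (toC (Φ f))))) :
    height d f < height d (conj f γ) := by
  obtain ⟨hC, hk, hbd⟩ := hCk
  set F := toC (Φ f) with hF
  have hn := hst.totalDegree_ne_zero
  have hreal : zPt F ∈ realPlane := zPt_mem_realPlane hst
  have h0 : Φ f ≠ 0 := by
    intro h
    apply hst.ne_zero
    rw [hF, h, toC, map_zero]
  obtain ⟨p, hp, h⟩ := hst.exists_stableFam
  have hθ : 0 < theta F := by
    rw [theta, hp.bigR_eq h]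
    exact famR_pos hp.1 _
  have hθj : theta F ≤ 2 ^ (F.totalDegree - 1) * (C * height d f ^ k) := by
    have h1 : bigR F jPt ≤ 2 ^ (F.totalDegree - 1) * size F := by
      have := bigR_jPt_le_size hn hp.1
      rwa [← h] at this
    refine (hst.zPt_minimizer jPt).trans (h1.trans ?_)
    exact mul_le_mul_of_nonneg_left (hbd f hf) (by positivity)
  have key := lt_bigR_of_searchBound_lt hst hP hreal (s := C * height d f ^ k) (by
    rwa [← mul_div_assoc, one_le_div hθ]) hγ
  have h' : substHom (intSL γ) F = ∏ k, lin (vact (p k) (intSL γ)) := by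
    conv_lhs => rw [h]
    rw [substHom_prod_lin]
  have hsize : bigR (substHom (intSL γ) F) jPt ≤
      2 ^ (F.totalDegree - 1) * size (substHom (intSL γ) F) := by
    rw [h']
    exact bigR_jPt_le_size hn fun k => vact_ne_zero (hp.1 k) _
  have hsub : substHom (intSL γ) F = toC (Φ (conj f γ)) := by
    rw [conj_eq_substHom hΦ h0, toC_substHom]
  have hbd' := hbd (conj f γ) (hf.conj γ)
  rw [← hsub] at hbd'
  have h2 : (0 : ℝ) < 2 ^ (F.totalDegree - 1) := by positivity
  have h3 := lt_of_mul_lt_mul_left (key.trans_le hsize) h2.le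
  have h4 := lt_of_mul_lt_mul_left (h3.trans_le hbd') hC.le
  exact (Real.rpow_lt_rpow_iff (zero_le_one.trans (one_le_height d f))
    (zero_le_one.trans (one_le_height d _)) hk).mp h4

end Reduction

end

end EndoBound

open EndoBound
theorem corollary5p2 (d m : ℕ) (hd : 2 ≤ d) (hm : 1 ≤ m)
    (Φ : (Fin 2 → FormPoly ℤ) → FormPoly ℤ) (hΦ : Φ = periodForm m ∨ Φ = dynatomicForm m) :
    (∃ C k : ℝ, IsSizeBound d Φ C k) ∧
    ∀ C k : ℝ, IsSizeBound d Φ C k →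
    ∀ P : Set HSpace, P = Set.univ ∨ P = realPlane →
    ∀ f : Fin 2 → FormPoly ℤ, IsModel d f → IsStable (toC (Φ f)) →
      (∀ γ : SL(2, ℤ),
        searchBound P (toC (Φ f)) (C * height d f ^ k) <
            coshToJ (moeb (intSL γ)⁻¹ (zPt (toC (Φ f)))) →
          height d f < height d (conj f γ)) ∧
      {γ : SL(2, ℤ) | coshToJ (moeb (intSL γ)⁻¹ (zPt (toC (Φ f)))) ≤
          searchBound P (toC (Φ f)) (C * height d f ^ k)}.Finite ∧
      ∃ γ₀ : SL(2, ℤ),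
        coshToJ (moeb (intSL γ₀)⁻¹ (zPt (toC (Φ f)))) ≤
            searchBound P (toC (Φ f)) (C * height d f ^ k) ∧
          ∀ γ : SL(2, ℤ), height d (conj f γ₀) ≤ height d (conj f γ) := by

  have hbdd : PolyBdd d fun f => size (toC (Φ f)) := by
    rcases hΦ with rfl | rfl
    · exact polyBdd_size_periodForm d m
    · exact polyBdd_size_dynatomicForm d m
  refine ⟨exists_isSizeBound hbdd, fun C k hCk P hP f hf hst => ?_⟩
  have hii : ∀ γ : SL(2, ℤ), searchBound P (toC (Φ f)) (C * height d f ^ k) <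
      coshToJ (moeb (intSL γ)⁻¹ (zPt (toC (Φ f)))) → height d f < height d (conj f γ) :=
    fun γ hγ => height_lt_height_conj hΦ hCk hP hf hst hγ
  have hfin := finite_coshToJ_le (zPt (toC (Φ f))) (searchBound P (toC (Φ f)) (C * height d f ^ k))
  refine ⟨hii, hfin, ?_⟩
  -- Outside the region the identity would give `H(f) < H(f)`. So the minimum over the region is at
  -- most `H(f)`, and no `γ` outside can beat it.
  have hone : coshToJ (moeb (intSL 1)⁻¹ (zPt (toC (Φ f)))) ≤
      searchBound P (toC (Φ f)) (C * height d f ^ k) := by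
    by_contra h
    have := hii 1 (not_le.mp h)
    rw [conj_unit] at this
    exact lt_irrefl _ this
  obtain ⟨γ₀, hγ₀, hmin⟩ := Set.exists_min_image _ (fun γ => height d (conj f γ)) hfin ⟨1, hone⟩
  refine ⟨γ₀, hγ₀, fun γ => ?_⟩
  by_cases hγ : coshToJ (moeb (intSL γ)⁻¹ (zPt (toC (Φ f)))) ≤
      searchBound P (toC (Φ f)) (C * height d f ^ k)
  · exact hmin γ hγ
  · have h1 := hmin 1 hone
    rw [conj_unit] at h1
    exact h1.trans (hii γ (not_le.mp hγ)).le
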